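/- Let $P$ be the HOMFLY polynomial, that is, the unique function that assigns to every oriented link diagram (with at least one component) an element of $\mathbb{C}[l^{\pm1},m^{\pm1}]$, is invariant under isotopy of oriented links, and satisfies $P(\bigcirc)=1$ and $l\,P(L_+)+l^{-1}P(L_-)+m\,P(L_0)=0$ whenever $L_+,L_-,L_0$ are oriented link diagrams that are the same except near one crossing, which is positive in $L_+$, negative in $L_-$, and smoothed compatibly with the orientations in $L_0$. Such a function $P$ exists and is unique. Let $D(L)\in\mathbb{C}[s^{\pm1}]$ be its specialization at $l=s$, $m=-2$ (so $D(\bigcirc)=1$ and $sD(L_+)+s^{-1}D(L_-)-2D(L_0)=0$). Then for all nonempty oriented links $L,L_1,L_2$: 1. $D(L_1\sqcup L_2)=\dfrac{s^2+1}{2s}\,D(L_1)\,D(L_2)$, where $L_1\sqcup L_2$ is the distant union of $L_1$ and $L_2$; 2. $D(\overline{L})(s)=D(L)(s^{-1})$, where $\overline{L}$ is the mirror image of $L$; 3. $D(L_1+L_2)=D(L_1)\,D(L_2)$ for every connected sum $L_1+L_2$ of $L_1$ and $L_2$ (with respect to any choice of a component of $L_1$ and a component of $L_2$); 4. $D(\overleftarrow{L})=D(L)$,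 where $\overleftarrow{L}$ is $L$ with the orientation of every component reversed. -/

import Mathlib

open scoped LaurentPolynomial

/-!
Oriented link diagrams in the plane, drawn in general position with respect to the height function
and read from bottom to top. Such a diagram is a finite sequence of horizontal layers; each layer
consists of vertical strands and exactly one minimum, maximum or crossing. A horizontal line that
avoids these points meets the diagram in a finite row of strands, recorded from left to right as a
list of directions: `true` for a strand that is oriented upwards, `false` for one oriented downwards.
-/

namespace OrientedLinks

/-- The elementary pieces of an oriented diagram. -/
inductive Piece : Type
  /-- A local minimum; it creates two neighbouring strands with directions `o, !o`. -/
  | cup (o : Bool)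
  /-- A local maximum; it joins two neighbouring strands with directions `o, !o`. -/
  | cap (o : Bool)
  /-- A crossing. The strand with direction `a` runs between bottom left and top right, the strand
  with direction `b` between bottom right and top left. If `v` is `true`, the former is the
  overcrossing strand, otherwise the latter is. -/
  | cross (v a b : Bool)

/-- The strands at the bottom of a piece. -/
def Piece.bot : Piece → List Bool
  | .cup _ => []
  | .cap o => [o, !o]
  | .cross _ a b => [a, b]

/-- The strands at the top of a piece. -/
def Piece.top : Piece → List Bool
  | .cup o => [o, !o]
  | .cap _ => []
  | .cross _ a b => [b, a]

/-- A layer: one piece with vertical strands to its left and to its right. -/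
structure Layer : Type where
  left : List Bool
  piece : Piece
  right : List Bool

/-- The strands at the bottom of a layer. -/
def Layer.bot (e : Layer) : List Bool := e.left ++ e.piece.bot ++ e.right

/-- The strands at the top of a layer. -/
def Layer.top (e : Layer) : List Bool := e.left ++ e.piece.top ++ e.right

/-- `Goes x w y`: the layers of `w`, stacked from bottom to top, fit together to an oriented tangle
diagram with the row `x` of strands at the bottom and the row `y` at the top. -/
def Goes : List Bool → List Layer → List Bool → Prop
  | x, [], y => x = y
  | x, e :: w, y => e.bot = x ∧ Goes e.top w y

/-- Adding vertical strands on both sides of a tangle diagram. -/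
def pad (x y : List Bool) (w : List Layer) : List Layer :=
  w.map fun e => ⟨x ++ e.left, e.piece, e.right ++ y⟩

/-- Oriented link diagrams with at least one component: nonempty tangle diagrams without
end points. -/
structure LinkDiagram : Type where
  word : List Layer
  ne_nil : word ≠ []
  goes : Goes [] word []

/-- The local moves between oriented tangle diagrams with the same end points: planar isotopies and
the three Reidemeister moves. All directions of the strands and all choices of the over- and
undercrossing strands that make sense are allowed. -/
inductive Move : List Layer → List Layer → Prop
  /-- Planar isotopy: exchanging the heights of two distant pieces. -/
  | exchange (p : Piece) (y : List Bool) (q : Piece) :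
      Move [⟨[], p, y ++ q.bot⟩, ⟨p.top ++ y, q, []⟩] [⟨p.bot ++ y, q, []⟩, ⟨[], p, y ++ q.top⟩]
  /-- Planar isotopy: straightening a minimum followed by a maximum to its left. -/
  | zigzagLeft (a : Bool) : Move [⟨[a], .cup (!a), []⟩, ⟨[], .cap a, [a]⟩] []
  /-- Planar isotopy: straightening a minimum followed by a maximum to its right. -/
  | zigzagRight (a : Bool) : Move [⟨[], .cup a, [a]⟩, ⟨[a], .cap (!a), []⟩] []
  /-- Planar isotopy: moving a crossing with a strand `c` from one side of a maximum to the
  other. -/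
  | slideCap (v c o : Bool) :
      Move [⟨[o], .cross v c (!o), []⟩, ⟨[], .cap o, [c]⟩]
        [⟨[], .cross (!v) o c, [!o]⟩, ⟨[c], .cap o, []⟩]
  /-- Planar isotopy: moving a crossing with a strand `c` from one side of a minimum to the
  other. -/
  | slideCup (v c o : Bool) :
      Move [⟨[c], .cup o, []⟩, ⟨[], .cross v c o, [!o]⟩]
        [⟨[], .cup o, [c]⟩, ⟨[o], .cross (!v) (!o) c, []⟩]
  /-- First Reidemeister move, at a maximum. -/
  | reidemeisterOneCap (v a : Bool) :
      Move [⟨[], .cross v a (!a), []⟩, ⟨[], .cap (!a), [] ⟩] [⟨[], .cap a, []⟩]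
  /-- First Reidemeister move, at a minimum. -/
  | reidemeisterOneCup (v a : Bool) :
      Move [⟨[], .cup a, []⟩, ⟨[], .cross v a (!a), []⟩] [⟨[], .cup (!a), []⟩]
  /-- Second Reidemeister move. -/
  | reidemeisterTwo (v a b : Bool) :
      Move [⟨[], .cross v a b, []⟩, ⟨[], .cross (!v) b a, []⟩] []
  /-- Third Reidemeister move for three strands `a`, `b`, `c`; `v₁`, `v₂`, `v₃` tell which strand
  is over for the pairs `(a, b)`, `(b, c)`, `(a, c)`. The hypothesis says that the three strands lie
  on three different levels, that is, being over is not cyclic. -/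
  | reidemeisterThree (v₁ v₂ v₃ a b c : Bool) (h : v₁ = v₂ → v₃ = v₁) :
      Move [⟨[], .cross v₁ a b, [c]⟩, ⟨[b], .cross v₃ a c, []⟩, ⟨[], .cross v₂ b c, [a]⟩]
        [⟨[a], .cross v₂ b c, []⟩, ⟨[], .cross v₃ a c, [b]⟩, ⟨[c], .cross v₁ a b, []⟩]

/-- Two link diagrams differ by a local move, applied somewhere in the diagram. -/
def Step (L L' : LinkDiagram) : Prop :=
  ∃ (u w p q : List Layer) (x y : List Bool), Move p q ∧
    L.word = u ++ pad x y p ++ w ∧ L'.word = u ++ pad x y q ++ w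

/-- Two link diagrams represent the same (isotopic) oriented links: they are connected by finitely
many planar isotopies and Reidemeister moves and their inverses. -/
def Isotopic (L L' : LinkDiagram) : Prop := Relation.EqvGen Step L L'

/-- The round circle, a diagram of the unknot. -/
def unknot : LinkDiagram where
  word := [⟨[], .cup true, []⟩, ⟨[], .cap true, []⟩]
  ne_nil := by simp
  goes := by simp [Goes, Layer.bot, Layer.top, Piece.bot, Piece.top]

/-- The sign of the crossing `Piece.cross v a b` is positive (`true`) if the overcrossing strand has
to be turned counterclockwise, by less than a straight angle, to get the direction of the
undercrossing strand. -/
def isPositive (v a b : Bool) : Bool := v == (a == b)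

/-- What replaces a crossing of strands with directions `a`, `b` when it is smoothed in the way that
respects the orientations: two vertical strands if `a = b`, otherwise a maximum below a minimum. -/
def smoothing (a b : Bool) (x y : List Bool) : List Layer :=
  if a = b then [] else [⟨x, .cap a, y⟩, ⟨x, .cup b, y⟩]

/-- The three diagrams are the same except in the neighbourhood of one crossing, which is positive
in `Lp`, negative in `Lm`, and smoothed in `Lz`. -/
def SkeinTriple (Lp Lm Lz : LinkDiagram) : Prop :=
  ∃ (u w : List Layer) (x y : List Bool) (vp vm a b : Bool),
    isPositive vp a b = true ∧ isPositive vm a b = false ∧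
    Lp.word = u ++ [⟨x, .cross vp a b, y⟩] ++ w ∧
    Lm.word = u ++ [⟨x, .cross vm a b, y⟩] ++ w ∧
    Lz.word = u ++ smoothing a b x y ++ w

/-- The ring `ℂ[l^±1, m^±1]`, as Laurent polynomials in `m` over Laurent polynomials in `l`. -/
abbrev LaurentLM : Type := ℂ[T;T⁻¹][T;T⁻¹]

/-- `P` is an isotopy invariant of oriented links with `P(○) = 1` and
`l P(L₊) + l⁻¹ P(L₋) + m P(L₀) = 0`. -/
structure IsHomfly (P : LinkDiagram → LaurentLM) : Prop where
  invariant : ∀ L L', Isotopic L L' → P L = P L'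
  normalization : P unknot = 1
  skein : ∀ Lp Lm Lz, SkeinTriple Lp Lm Lz →
    LaurentPolynomial.C (LaurentPolynomial.T 1) * P Lp +
      LaurentPolynomial.C (LaurentPolynomial.T (-1)) * P Lm +
      LaurentPolynomial.T 1 * P Lz = 0

/-- The HOMFLY polynomial of oriented links. -/
noncomputable def homfly : LinkDiagram → LaurentLM := Classical.epsilon IsHomfly

/-- The constant `-2` as a unit of the ring `ℂ[s^±1]`. -/
noncomputable def negTwo : (ℂ[T;T⁻¹])ˣ :=
  Units.map (LaurentPolynomial.C : ℂ →+* ℂ[T;T⁻¹]).toMonoidHom (Units.mk0 (-2 : ℂ) (by norm_num))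

/-- The substitution `l = s`, `m = -2`. -/
noncomputable def specialize : LaurentLM →+* ℂ[T;T⁻¹] :=
  LaurentPolynomial.eval₂ (RingHom.id ℂ[T;T⁻¹]) negTwo

/-- The degenerate polynomial `D(L) ∈ ℂ[s^±1]`, the specialization `l = s`, `m = -2` of the HOMFLY
polynomial. -/
noncomputable def degenerateD (L : LinkDiagram) : ℂ[T;T⁻¹] := specialize (homfly L)

theorem Goes.append {x y z : List Bool} {w w' : List Layer} (h : Goes x w y) (h' : Goes y w' z) :
    Goes x (w ++ w') z := by
  induction w generalizing x with
  | nil => cases h; exact h'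
  | cons e w ih => exact ⟨h.1, ih h.2⟩

/-- The distant union of two links: the second diagram is drawn above the first, disjoint from
it. -/
def LinkDiagram.union (L₁ L₂ : LinkDiagram) : LinkDiagram where
  word := L₁.word ++ L₂.word
  ne_nil := by simp [L₁.ne_nil]
  goes := L₁.goes.append L₂.goes

/-- Exchanging the over- and undercrossing strands. -/
def Piece.mirror : Piece → Piece
  | .cup o => .cup o
  | .cap o => .cap o
  | .cross v a b => .cross (!v) a b

/-- Mirror image of a layer in the plane of the diagram. -/
def Layer.mirror (e : Layer) : Layer := ⟨e.left, e.piece.mirror, e.right⟩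

theorem Goes.mirror {x y : List Bool} {w : List Layer} (h : Goes x w y) :
    Goes x (w.map Layer.mirror) y := by
  induction w generalizing x with
  | nil => exact h
  | cons e w ih =>
    obtain ⟨l, p, r⟩ := e
    refine ⟨?_, ?_⟩
    · have := h.1
      cases p <;> exact this
    · have := ih h.2
      cases p <;> exact this

/-- The mirror image of a link: all crossings of the diagram are changed. -/
def LinkDiagram.mirror (L : LinkDiagram) : LinkDiagram where
  word := L.word.map Layer.mirror
  ne_nil := by simp [L.ne_nil]
  goes := L.goes.mirror

/-- Reversing the directions of the strands of a piece. -/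
def Piece.reverse : Piece → Piece
  | .cup o => .cup (!o)
  | .cap o => .cap (!o)
  | .cross v a b => .cross v (!a) (!b)

/-- Reversing the directions of all strands of a layer. -/
def Layer.reverse (e : Layer) : Layer := ⟨e.left.map not, e.piece.reverse, e.right.map not⟩

theorem Layer.bot_reverse (e : Layer) : e.reverse.bot = e.bot.map not := by
  obtain ⟨l, p, r⟩ := e
  cases p <;> simp [Layer.reverse, Layer.bot, Piece.reverse, Piece.bot]

theorem Layer.top_reverse (e : Layer) : e.reverse.top = e.top.map not := by
  obtain ⟨l, p, r⟩ := e
  cases p <;> simp [Layer.reverse, Layer.top, Piece.reverse, Piece.top]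

theorem Goes.reverse {x y : List Bool} {w : List Layer} (h : Goes x w y) :
    Goes (x.map not) (w.map Layer.reverse) (y.map not) := by
  induction w generalizing x with
  | nil => cases h; rfl
  | cons e w ih =>
    refine ⟨by rw [Layer.bot_reverse, h.1], ?_⟩
    rw [Layer.top_reverse]
    exact ih h.2

/-- The link with the reversed orientation of every component. -/
def LinkDiagram.reverse (L : LinkDiagram) : LinkDiagram where
  word := L.word.map Layer.reverse
  ne_nil := by simp [L.ne_nil]
  goes := L.goes.reverse

/-- The closure of a tangle diagram with one end point at the bottom and one at the top. -/
def closure (o : Bool) (t : List Layer) : List Layer :=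
  [⟨[], .cup o, []⟩] ++ pad [] [!o] t ++ [⟨[], .cap o, []⟩]

/-- `L` is a connected sum of `L₁` and `L₂`, with respect to some choice of a component of each:
up to isotopy, `L₂` is the closure of a tangle `t` with one end point at the bottom and one at the
top, and `L` arises from `L₁` by inserting `t` into some strand of a diagram of `L₁`, compatibly with
the orientations. -/
def IsConnectedSum (L₁ L₂ L : LinkDiagram) : Prop :=
  ∃ (u w t : List Layer) (x y : List Bool) (o : Bool) (K₁ K₂ K : LinkDiagram),
    Goes [] u (x ++ [o] ++ y) ∧ Goes (x ++ [o] ++ y) w [] ∧ Goes [o] t [o] ∧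
    K₁.word = u ++ w ∧ K₂.word = closure o t ∧ K.word = u ++ pad x y t ++ w ∧
    Isotopic L₁ K₁ ∧ Isotopic L₂ K₂ ∧ Isotopic L K

end OrientedLinks

/-! The four properties follow formally once the HOMFLY polynomial is known to exist and to be
unique, and once the skein module of one-strand tangles is known to have a single generator.
Generation: modulo isotopy and the skein relation, every tangle without end points at the bottom is
generated by standard diagrams, made of arcs each lying over all earlier ones (`spanned_of_goes`).
The proof adds layers one by one, by induction on the number of strands. Consequently one minimum
generates all tangles with two end points at the top (`gen_cup`), and the unknot generates all
nonempty links (`gen_unknot`). As `l` and `m` are units, a derivation yields a coefficient in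
`LaurentLM` that is valid for every invariant satisfying the relation (`Gen.exists_eval`). This
proves uniqueness. Existence: the coefficient is chosen arbitrarily for each diagram
(`LinkDiagram.eval`), and its consistency is tested numerically. For every `N > 0` and real `q > 1`,
the `R`-matrix state sum with `N` colours is an invariant satisfying the relation at `l = i q^N`, `m
= -i (q - q⁻¹)`, and it does not vanish on the unknot. These points separate Laurent polynomials in
two variables (`laurentLM_eq_zero`), so any relation that holds for all skein invariants holds for
the coefficients (`eval_relation`). Properties: the mirror image with `l` and `l⁻¹` exchanged, and
the reversal, again define HOMFLY functions, so uniqueness applies. For connected sums, a one-strand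
tangle is a multiple of the trivial one, and the same multiple appears in the closure and in the
sum. For distant unions, both factors reduce to unknots, and two circles are the smoothing of a curl
of one circle. -/

namespace OrientedLinks

/-! ### Rows of tangle words -/

@[simp] theorem goes_nil {x y : List Bool} : Goes x [] y ↔ x = y := Iff.rfl

@[simp] theorem goes_cons {x y : List Bool} {e : Layer} {w : List Layer} :
    Goes x (e :: w) y ↔ e.bot = x ∧ Goes e.top w y := Iff.rfl

theorem goes_append {x y : List Bool} {u w : List Layer} :
    Goes x (u ++ w) y ↔ ∃ m, Goes x u m ∧ Goes m w y := by
  induction u generalizing x with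
  | nil => simp
  | cons e u ih => simp [ih, and_assoc]

theorem Goes.top_unique {x y y' : List Bool} {w : List Layer} (h : Goes x w y)
    (h' : Goes x w y') : y = y' := by
  induction w generalizing x with
  | nil => exact h.symm.trans h'
  | cons e w ih => exact ih h.2 h'.2

theorem Goes.bot_unique {x x' y y' : List Bool} {w : List Layer} (hw : w ≠ []) (h : Goes x w y)
    (h' : Goes x' w y') : x = x' := by
  cases w with
  | nil => exact absurd rfl hw
  | cons e w => exact h.1.symm.trans h'.1

@[simp] theorem pad_nil (a b : List Bool) : pad a b [] = [] := rfl

@[simp] theorem pad_cons (a b : List Bool) (e : Layer) (w : List Layer) :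
    pad a b (e :: w) = ⟨a ++ e.left, e.piece, e.right ++ b⟩ :: pad a b w := rfl

@[simp] theorem pad_append (a b : List Bool) (u w : List Layer) :
    pad a b (u ++ w) = pad a b u ++ pad a b w := List.map_append ..

@[simp] theorem pad_pad (a b a' b' : List Bool) (w : List Layer) :
    pad a b (pad a' b' w) = pad (a ++ a') (b' ++ b) w := by
  simp [pad, Function.comp_def]

@[simp] theorem pad_nil_nil (w : List Layer) : pad [] [] w = w := by
  simp [pad]

theorem pad_ne_nil {a b : List Bool} {w : List Layer} (hw : w ≠ []) : pad a b w ≠ [] := by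
  simpa [pad] using hw

theorem goes_pad (a b : List Bool) {x y : List Bool} {w : List Layer} (h : Goes x w y) :
    Goes (a ++ x ++ b) (pad a b w) (a ++ y ++ b) := by
  induction w generalizing x with
  | nil => cases h; rfl
  | cons e w ih =>
    rw [pad_cons, goes_cons]
    refine ⟨?_, ?_⟩
    · rw [← h.1]; simp [Layer.bot]
    · have := ih h.2
      simpa [Layer.top] using this

theorem goes_pad_inv {a b x Y : List Bool} {w : List Layer}
    (h : Goes (a ++ x ++ b) (pad a b w) Y) : ∃ y, Y = a ++ y ++ b ∧ Goes x w y := by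
  induction w generalizing x with
  | nil => exact ⟨x, h.symm, rfl⟩
  | cons e w ih =>
    rw [pad_cons, goes_cons] at h
    obtain ⟨h1, h2⟩ := h
    have hx : e.bot = x := by
      simp only [Layer.bot, List.append_assoc, List.append_cancel_left_eq] at h1 ⊢
      simpa only [← List.append_assoc, List.append_cancel_right_eq] using h1
    have h2' : Goes (a ++ e.top ++ b) (pad a b w) Y := by simpa [Layer.top] using h2
    obtain ⟨y, hy, hg⟩ := ih h2'
    exact ⟨y, hy, hx, hg⟩

theorem goes_pad_inv_of_ne_nil {a b X Y : List Bool} {w : List Layer} (hw : w ≠ [])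
    (h : Goes X (pad a b w) Y) : ∃ x y, X = a ++ x ++ b ∧ Y = a ++ y ++ b ∧ Goes x w y := by
  cases w with
  | nil => exact absurd rfl hw
  | cons e w =>
    have hX : X = a ++ e.bot ++ b := by rw [← h.1]; simp [Layer.bot]
    subst hX
    obtain ⟨y, hy⟩ := goes_pad_inv h
    exact ⟨_, y, rfl, hy⟩

theorem Move.goes {p q : List Layer} (h : Move p q) : ∃ x y, Goes x p y ∧ Goes x q y := by
  cases h <;>
  simp [Layer.bot, Layer.top, Piece.bot, Piece.top]

theorem Move.ne_nil {p q : List Layer} (h : Move p q) : p ≠ [] := by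
  cases h <;> simp

theorem Move.goes_right {p q : List Layer} (h : Move p q) {a b X Y : List Bool}
    (hp : Goes X (pad a b p) Y) : Goes X (pad a b q) Y := by
  obtain ⟨x, y, rfl, rfl, h1⟩ := goes_pad_inv_of_ne_nil h.ne_nil hp
  obtain ⟨x', y', h2, h3⟩ := h.goes
  obtain rfl := h1.bot_unique h.ne_nil h2
  obtain rfl := h1.top_unique h2
  exact goes_pad a b h3

theorem Move.goes_left {p q : List Layer} (h : Move p q) (hq : q ≠ []) {a b X Y : List Bool}
    (hp : Goes X (pad a b q) Y) : Goes X (pad a b p) Y := by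
  obtain ⟨x, y, rfl, rfl, h1⟩ := goes_pad_inv_of_ne_nil hq hp
  obtain ⟨x', y', h2, h3⟩ := h.goes
  obtain rfl := h1.bot_unique hq h3
  obtain rfl := h1.top_unique h3
  exact goes_pad a b h2

/-! ### Isotopy of tangle words -/

/-- A local move applied somewhere in a tangle word with bottom row `x` and top row `y`. -/
def TangleStep (x y : List Bool) (w w' : List Layer) : Prop :=
  Goes x w y ∧ Goes x w' y ∧ ∃ (u t p q : List Layer) (a b : List Bool), Move p q ∧
    w = u ++ pad a b p ++ t ∧ w' = u ++ pad a b q ++ t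

/-- Isotopy of tangle words with bottom row `x` and top row `y`. -/
def Iso (x y : List Bool) (w w' : List Layer) : Prop :=
  Goes x w y ∧ Relation.EqvGen (TangleStep x y) w w'

theorem Iso.goes_right {x y : List Bool} {w w' : List Layer} (h : Iso x y w w') :
    Goes x w' y := by
  have key : Goes x w y ↔ Goes x w' y := by
    obtain ⟨-, h⟩ := h
    induction h with
    | rel _ _ h => exact ⟨fun _ => h.2.1, fun _ => h.1⟩
    | refl => rfl
    | symm _ _ _ ih => exact ih.symm
    | trans _ _ _ _ _ ih ih' => exact ih.trans ih'
  exact key.1 h.1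

theorem Iso.refl {x y : List Bool} {w : List Layer} (h : Goes x w y) : Iso x y w w :=
  ⟨h, .refl _⟩

theorem Iso.symm {x y : List Bool} {w w' : List Layer} (h : Iso x y w w') : Iso x y w' w :=
  ⟨h.goes_right, .symm _ _ h.2⟩

theorem Iso.trans {x y : List Bool} {u v w : List Layer} (h : Iso x y u v) (h' : Iso x y v w) :
    Iso x y u w :=
  ⟨h.1, .trans _ _ _ h.2 h'.2⟩

theorem eqvGen_map {α β : Type*} {r : α → α → Prop} {s : β → β → Prop} (f : α → β)
    (hf : ∀ a b, r a b → s (f a) (f b)) {a b : α} (h : Relation.EqvGen r a b) :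
    Relation.EqvGen s (f a) (f b) := by
  induction h with
  | rel _ _ h => exact .rel _ _ (hf _ _ h)
  | refl => exact .refl _
  | symm _ _ _ ih => exact .symm _ _ ih
  | trans _ _ _ _ _ ih ih' => exact .trans _ _ _ ih ih'

theorem Iso.context {x y X Y : List Bool} {w w' : List Layer} (h : Iso x y w w')
    (a b : List Bool) {u t : List Layer} (hu : Goes X u (a ++ x ++ b))
    (ht : Goes (a ++ y ++ b) t Y) : Iso X Y (u ++ pad a b w ++ t) (u ++ pad a b w' ++ t) := by
  refine ⟨(hu.append (goes_pad a b h.1)).append ht,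
    eqvGen_map (fun w => u ++ pad a b w ++ t) ?_ h.2⟩
  rintro w w' ⟨h1, h2, u', t', p, q, a', b', hm, rfl, rfl⟩
  exact ⟨(hu.append (goes_pad a b h1)).append ht, (hu.append (goes_pad a b h2)).append ht,
    u ++ pad a b u', pad a b t' ++ t, p, q, a ++ a', b' ++ b, hm, by simp, by simp⟩

/-- Wherever the first word fits, the second one fits and is isotopic to it. -/
def Red (w w' : List Layer) : Prop := ∀ x y, Goes x w y → Iso x y w w'

infix:25 " ⇝ " => Red

/-- The words fit in the same places and are isotopic. -/
def Eqv (w w' : List Layer) : Prop := (w ⇝ w') ∧ (w' ⇝ w)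

infix:25 " ≈ₜ " => Eqv

theorem Red.refl (w : List Layer) : w ⇝ w := fun _ _ h => .refl h

theorem Red.of_eq {w w' : List Layer} (h : w = w') : w ⇝ w' := h ▸ Red.refl w

theorem Red.trans {u v w : List Layer} (h : u ⇝ v) (h' : v ⇝ w) : u ⇝ w :=
  fun x y hg => (h x y hg).trans (h' x y (h x y hg).goes_right)

theorem Red.goes {w w' : List Layer} (h : w ⇝ w') {x y : List Bool} (hg : Goes x w y) :
    Goes x w' y := (h x y hg).goes_right

theorem Red.append {u u' w w' : List Layer} (h : u ⇝ u') (h' : w ⇝ w') :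
    u ++ w ⇝ u' ++ w' := by
  intro x y hg
  obtain ⟨m, h1, h2⟩ := goes_append.1 hg
  have i1 : Iso x y (u ++ w) (u' ++ w) := by
    simpa using (h x m h1).context [] [] (u := []) (t := w) (X := x) (Y := y) (by simp)
      (by simpa using h2)
  have i2 : Iso x y (u' ++ w) (u' ++ w') := by
    simpa using (h' m y h2).context [] [] (u := u') (t := []) (X := x) (Y := y)
      (by simpa using h.goes h1) (by simp)
  exact i1.trans i2

/-- The first layer of a nonempty word determines its bottom row, so only the empty word fits over
every row. -/
theorem goes_eq_nil {w : List Layer} (h : ∀ x, Goes x w x) : w = [] := by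
  cases w with
  | nil => rfl
  | cons e w =>
    have h1 := (h []).1
    have h2 := (h [true]).1
    rw [h1] at h2
    cases h2

theorem Red.pad {w w' : List Layer} (h : w ⇝ w') (a b : List Bool) :
    pad a b w ⇝ pad a b w' := by
  intro X Y hg
  rcases eq_or_ne w [] with rfl | hw
  · obtain rfl : w' = [] := goes_eq_nil fun x => h.goes (x := x) rfl
    exact .refl hg
  · obtain ⟨x, y, rfl, rfl, hxy⟩ := goes_pad_inv_of_ne_nil hw hg
    simpa using (h x y hxy).context a b (u := []) (t := []) rfl rfl

theorem Move.red {p q : List Layer} (h : Move p q) : p ⇝ q := fun x y hp =>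
  ⟨hp, .rel _ _ ⟨hp, by simpa using h.goes_right (a := []) (b := []) (by simpa using hp),
    [], [], p, q, [], [], h, by simp, by simp⟩⟩

/-- Moves ending in the empty word give only `⇝`: the empty word fits over every row, a zigzag or a
pair of crossings over just one. -/
theorem Move.eqv {p q : List Layer} (h : Move p q) (hq : q ≠ []) : p ≈ₜ q :=
  ⟨h.red, fun x y hg => (h.red x y
    (by simpa using h.goes_left hq (a := []) (b := []) (by simpa using hg))).symm⟩

theorem Eqv.refl (w : List Layer) : w ≈ₜ w := ⟨.refl w, .refl w⟩

theorem Eqv.symm {w w' : List Layer} (h : w ≈ₜ w') : w' ≈ₜ w := ⟨h.2, h.1⟩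

theorem Eqv.trans {u v w : List Layer} (h : u ≈ₜ v) (h' : v ≈ₜ w) : u ≈ₜ w :=
  ⟨h.1.trans h'.1, h'.2.trans h.2⟩

theorem Eqv.append {u u' w w' : List Layer} (h : u ≈ₜ u') (h' : w ≈ₜ w') :
    u ++ w ≈ₜ u' ++ w' := ⟨h.1.append h'.1, h.2.append h'.2⟩

theorem Eqv.pad {w w' : List Layer} (h : w ≈ₜ w') (a b : List Bool) :
    pad a b w ≈ₜ pad a b w' := ⟨h.1.pad a b, h.2.pad a b⟩

/-- Replacing a part of a word. -/
theorem Red.within {p q : List Layer} (h : p ⇝ q) (a b : List Bool) (u t : List Layer) :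
    u ++ OrientedLinks.pad a b p ++ t ⇝ u ++ OrientedLinks.pad a b q ++ t :=
  ((Red.refl u).append (h.pad a b)).append (.refl t)

theorem Eqv.within {p q : List Layer} (h : p ≈ₜ q) (a b : List Bool) (u t : List Layer) :
    u ++ OrientedLinks.pad a b p ++ t ≈ₜ u ++ OrientedLinks.pad a b q ++ t :=
  ⟨h.1.within a b u t, h.2.within a b u t⟩

/-! ### Exchanging distant tangles -/

theorem exchange_layers (e f : Layer) :
    [⟨e.left, e.piece, e.right ++ f.bot⟩, ⟨e.top ++ f.left, f.piece, f.right⟩] ≈ₜ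
      [⟨e.bot ++ f.left, f.piece, f.right⟩, ⟨e.left, e.piece, e.right ++ f.top⟩] := by
  have := ((Move.exchange e.piece (e.right ++ f.left) f.piece).eqv (by simp)).pad e.left f.right
  simpa [Layer.top, Layer.bot] using this

theorem exchange_layer_word (e : Layer) {y y' : List Bool} {t : List Layer} (ht : Goes y t y') :
    [⟨e.left, e.piece, e.right ++ y⟩] ++ pad e.top [] t ≈ₜ
      pad e.bot [] t ++ [⟨e.left, e.piece, e.right ++ y'⟩] := by
  induction t generalizing y with
  | nil => cases ht; exact .refl _
  | cons f t ih =>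
    obtain ⟨rfl, h2⟩ := ht
    have h1 := (exchange_layers e f).append (.refl (pad e.top [] t))
    have h3 := (Eqv.refl [⟨e.bot ++ f.left, f.piece, f.right⟩]).append (ih h2)
    simpa using h1.trans (by simpa using h3)

/-- Two tangles side by side may be drawn in either order. -/
theorem exchange_words {x x' y y' : List Bool} {s t : List Layer} (hs : Goes x s x')
    (ht : Goes y t y') : pad [] y s ++ pad x' [] t ≈ₜ pad x [] t ++ pad [] y' s := by
  induction s generalizing x with
  | nil => cases hs; simpa using Eqv.refl _
  | cons e s ih =>
    obtain ⟨rfl, h2⟩ := hs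
    have h1 := (Eqv.refl [⟨e.left, e.piece, e.right ++ y⟩]).append (ih h2)
    have h3 := (exchange_layer_word e ht).append (.refl (pad [] y' s))
    simpa using h1.trans (by simpa using h3)

theorem Iso.eqv {x y : List Bool} {p q : List Layer} (h : Iso x y p q) (hp : p ≠ [])
    (hq : q ≠ []) : p ≈ₜ q := by
  refine ⟨fun x' y' hg => ?_, fun x' y' hg => ?_⟩
  · obtain rfl := hg.bot_unique hp h.1
    obtain rfl := hg.top_unique h.1
    exact h
  · obtain rfl := hg.bot_unique hq h.goes_right
    obtain rfl := hg.top_unique h.goes_right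
    exact h.symm

theorem Red.eqv {x y : List Bool} {p q : List Layer} (h : p ⇝ q) (hg : Goes x p y)
    (hp : p ≠ []) (hq : q ≠ []) : p ≈ₜ q := (h x y hg).eqv hp hq

/-! ### A strand that passes over a row of strands -/

/-- A strand with direction `s` passes over the row `y` from left to right. -/
def overRight (s : Bool) : List Bool → List Layer
  | [] => []
  | c :: y => ⟨[], .cross true s c, y⟩ :: pad [c] [] (overRight s y)

/-- A strand with direction `s` passes over the row `y` from right to left. -/
def overLeft (s : Bool) : List Bool → List Layer
  | [] => []
  | c :: y => pad [c] [] (overLeft s y) ++ [⟨[], .cross false c s, y⟩]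

@[simp] theorem overRight_nil (s : Bool) : overRight s [] = [] := rfl

@[simp] theorem overRight_cons (s c : Bool) (y : List Bool) :
    overRight s (c :: y) = ⟨[], .cross true s c, y⟩ :: pad [c] [] (overRight s y) := rfl

@[simp] theorem overLeft_nil (s : Bool) : overLeft s [] = [] := rfl

@[simp] theorem overLeft_cons (s c : Bool) (y : List Bool) : overLeft s (c :: y) =
    pad [c] [] (overLeft s y) ++ [⟨[], .cross false c s, y⟩] := rfl

theorem overRight_append (s : Bool) (y z : List Bool) :
    overRight s (y ++ z) = pad [] z (overRight s y) ++ pad y [] (overRight s z) := by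
  induction y with
  | nil => simp
  | cons c y ih => simp [ih]

theorem goes_overRight (s : Bool) (y : List Bool) : Goes (s :: y) (overRight s y) (y ++ [s]) := by
  induction y with
  | nil => rfl
  | cons c y ih =>
    refine ⟨by simp [Layer.bot, Piece.bot], ?_⟩
    simpa [Layer.top, Piece.top] using goes_pad [c] [] ih

theorem goes_overLeft (s : Bool) (y : List Bool) : Goes (y ++ [s]) (overLeft s y) (s :: y) := by
  induction y with
  | nil => rfl
  | cons c y ih =>
    refine (by simpa using goes_pad [c] [] ih : Goes _ _ (c :: s :: y)).append ?_
    simp [Layer.bot, Layer.top, Piece.bot, Piece.top]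

/-- Sliding the strand across the minimum produces two consecutive opposite crossings, which cancel
by the second Reidemeister move. -/
theorem overRight_natural_cup (s o : Bool) :
    overRight s [] ++ [⟨[], .cup o, [s]⟩] ≈ₜ [⟨[s], .cup o, []⟩] ++ overRight s [o, !o] := by
  refine Eqv.symm (Red.eqv (x := [s]) (y := [o, !o, s]) ?_ ?_ (by simp) (by simp))
  · have h1 := (Move.slideCup true s o).red.within [] [] [] [⟨[o], .cross true s (!o), []⟩]
    have h2 := (Move.reidemeisterTwo false (!o) s).red.within [o] [] [⟨[], .cup o, [s]⟩] []
    simp at h1 h2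
    simpa using h1.trans h2
  · simp [Layer.bot, Layer.top, Piece.bot, Piece.top]

theorem overRight_natural_cap (s o : Bool) :
    overRight s [o, !o] ++ [⟨[], .cap o, [s]⟩] ≈ₜ [⟨[s], .cap o, []⟩] ++ overRight s [] := by
  refine (Red.eqv (x := [s, o, !o]) (y := [s]) ?_ ?_ (by simp) (by simp))
  · have h1 := (Move.slideCap true s o).red.within [] [] [⟨[], .cross true s o, [!o]⟩] []
    have h2 := (Move.reidemeisterTwo true s o).red.within [] [!o] [] [⟨[s], .cap o, []⟩]
    simp at h1 h2
    simpa using h1.trans h2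
  · simp [Layer.bot, Layer.top, Piece.bot, Piece.top]

theorem overRight_natural_piece (s : Bool) (p : Piece) :
    overRight s p.bot ++ [⟨[], p, [s]⟩] ≈ₜ [⟨[s], p, []⟩] ++ overRight s p.top := by
  cases p with
  | cup o => exact overRight_natural_cup s o
  | cap o => exact overRight_natural_cap s o
  | cross v a b =>
    -- The passing strand is above the other two, so the levels are never cyclic, whatever `v` is.
    simpa [Piece.bot, Piece.top] using
      (Move.reidemeisterThree true v true s a b (fun _ => rfl)).eqv (by simp)

theorem goes_piece (p : Piece) : Goes p.bot [⟨[], p, []⟩] p.top := by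
  simp [Layer.bot, Layer.top]

theorem overRight_natural_layer (s : Bool) (e : Layer) :
    overRight s e.bot ++ pad [] [s] [e] ≈ₜ pad [s] [] [e] ++ overRight s e.top := by
  obtain ⟨l, p, r⟩ := e
  have h1 := (exchange_layer_word ⟨l, p, []⟩ (goes_overRight s r)).symm
  have h2 := (exchange_words (goes_overRight s l) (goes_piece p)).pad [] r
  have h3 := (overRight_natural_piece s p).pad l r
  have k1 := (Eqv.refl (pad [] (p.bot ++ r) (overRight s l) ++ pad l r (overRight s p.bot))).append h1
  have k2 := ((Eqv.refl (pad [] (p.bot ++ r) (overRight s l))).append h3).append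
    (.refl (pad (l ++ p.top) [] (overRight s r)))
  have k3 := h2.append (.refl (pad l r (overRight s p.top) ++ pad (l ++ p.top) [] (overRight s r)))
  simp [Layer.bot, Layer.top] at k1 k2 k3
  simpa [Layer.bot, Layer.top, overRight_append] using k1.trans (k2.trans k3)

theorem overRight_natural (s : Bool) {y y' : List Bool} {t : List Layer} (ht : Goes y t y') :
    overRight s y ++ pad [] [s] t ≈ₜ pad [s] [] t ++ overRight s y' := by
  induction t generalizing y with
  | nil => cases ht; simpa using Eqv.refl _
  | cons e t ih =>
    obtain ⟨rfl, h2⟩ := ht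
    have h1 := (overRight_natural_layer s e).append (.refl (pad [] [s] t))
    have h3 := (Eqv.refl (pad [s] [] [e])).append (ih h2)
    simp at h1 h3
    simpa using h1.trans h3

/-! ### Arcs that lie over the rest of the diagram -/

/-- An arc from the left end of the row to the point between `y` and `z`, over all other
strands. -/
def cupOver (a : Bool) (y z : List Bool) : List Layer :=
  ⟨[], .cup a, y ++ z⟩ :: pad [a] z (overRight (!a) y)

theorem goes_cupOver (a : Bool) (y z : List Bool) :
    Goes (y ++ z) (cupOver a y z) (a :: y ++ [!a] ++ z) := by
  refine ⟨by simp [Layer.bot, Piece.bot], ?_⟩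
  simpa [Layer.top, Piece.top] using goes_pad [a] z (goes_overRight (!a) y)

theorem pad_cupOver (b : List Bool) (a : Bool) (y z : List Bool) :
    pad [] b (cupOver a y z) = cupOver a y (z ++ b) := by
  simp [cupOver]

theorem cupOver_append (a : Bool) (y y' z : List Bool) :
    cupOver a (y ++ y') z = cupOver a y (y' ++ z) ++ pad (a :: y) z (overRight (!a) y') := by
  simp [cupOver, overRight_append]

theorem exchange_cup (a : Bool) {x x' : List Bool} {t : List Layer} (ht : Goes x t x') :
    [⟨[], .cup a, x⟩] ++ pad [a, !a] [] t ≈ₜ t ++ [⟨[], .cup a, x'⟩] := by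
  simpa [Layer.top, Layer.bot, Piece.top, Piece.bot] using
    exchange_layer_word ⟨[], .cup a, []⟩ ht

theorem exchange_cross (v a b : Bool) {x x' : List Bool} {t : List Layer} (ht : Goes x t x') :
    [⟨[], .cross v a b, x⟩] ++ pad [b, a] [] t ≈ₜ
      pad [a, b] [] t ++ [⟨[], .cross v a b, x'⟩] := by
  simpa [Layer.top, Layer.bot, Piece.top, Piece.bot] using
    exchange_layer_word ⟨[], .cross v a b, []⟩ ht

theorem exchange_cap (a : Bool) {x x' : List Bool} {t : List Layer} (ht : Goes x t x') :
    [⟨[], .cap a, x⟩] ++ t ≈ₜ pad [a, !a] [] t ++ [⟨[], .cap a, x'⟩] := by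
  simpa [Layer.top, Layer.bot, Piece.top, Piece.bot] using
    exchange_layer_word ⟨[], .cap a, []⟩ ht

/-- A tangle may be moved through the arc below it. -/
theorem cupOver_natural (a : Bool) {y y' : List Bool} (z : List Bool) {t : List Layer}
    (ht : Goes y t y') :
    cupOver a y z ++ pad [a] ((!a) :: z) t ≈ₜ pad [] z t ++ cupOver a y' z := by
  have h1 := (overRight_natural (!a) ht).within [a] z [⟨[], .cup a, y ++ z⟩] []
  have h2 := (exchange_cup a (by simpa using goes_pad [] z ht : Goes (y ++ z) (pad [] z t) (y' ++ z))).append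
    (.refl (pad [a] z (overRight (!a) y')))
  simp at h1 h2
  simpa [cupOver] using h1.trans h2

/-- A tangle on the right of the end point of an arc may be moved below the arc. -/
theorem cupOver_natural_right (a : Bool) (y : List Bool) {z z' : List Bool} {t : List Layer}
    (ht : Goes z t z') :
    cupOver a y z ++ pad (a :: y ++ [!a]) [] t ≈ₜ pad y [] t ++ cupOver a y z' := by
  have := exchange_words (by simpa using goes_cupOver a y []) ht
  simpa [pad_cupOver] using this

/-- Taking the first strand below the row to the left end of an arc. -/
theorem cupOver_cons (a c : Bool) (y z : List Bool) :
    cupOver a (c :: y) z ≈ₜ pad [c] [] (cupOver a y z) ++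
      [⟨[], .cross false c a, y ++ [!a] ++ z⟩] := by
  have h1 := ((Move.slideCup false c a).eqv (by simp)).symm.within [] (y ++ z) []
    (pad [a, c] z (overRight (!a) y))
  have h2 := (exchange_cross false c a (by simpa using goes_pad [] z (goes_overRight (!a) y) :
    Goes ((!a) :: (y ++ z)) (pad [] z (overRight (!a) y)) (y ++ [!a] ++ z)))
  have h3 := (Eqv.refl [⟨[c], .cup a, y ++ z⟩]).append h2
  simp at h1 h3
  simpa [cupOver] using h1.trans h3

theorem cupOver_cons_cancel (a c : Bool) (y z : List Bool) :
    cupOver a (c :: y) z ++ [⟨[], .cross true a c, y ++ [!a] ++ z⟩] ⇝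
      pad [c] [] (cupOver a y z) := by
  have h1 := (cupOver_cons a c y z).1.append (.refl [⟨[], .cross true a c, y ++ [!a] ++ z⟩])
  have h2 := (Move.reidemeisterTwo false c a).red.within [] (y ++ [!a] ++ z)
    (pad [c] [] (cupOver a y z)) []
  simp at h1 h2
  simpa using h1.trans h2

theorem cupOver_cross_left (a c : Bool) (y z : List Bool) :
    pad [a] [] (cupOver c y z) ++ [⟨[], .cross false a c, y ++ [!c] ++ z⟩] ≈ₜ
      cupOver c (a :: y) z := (cupOver_cons c a y z).symm

/-- Closing an arc with the neighbouring strand on its left end. -/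
theorem cupOver_cap_left (a : Bool) (y z : List Bool) :
    cupOver a ((!a) :: y) z ++ [⟨[], .cap a, y ++ [!a] ++ z⟩] ⇝ pad [] z (overRight (!a) y) := by
  -- Restarting the arc on the other side of the capped strand creates a curl at the maximum;
  -- without it, a zigzag remains.
  have h1 := (cupOver_cons a (!a) y z).1.append (.refl [⟨[], .cap a, y ++ [!a] ++ z⟩])
  have h2 := (Move.reidemeisterOneCap false (!a)).red.within [] (y ++ [!a] ++ z)
    (pad [!a] [] (cupOver a y z)) []
  have h3 := (exchange_cap (!a) (by simpa using goes_pad [] z (goes_overRight (!a) y) :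
    Goes ((!a) :: (y ++ z)) (pad [] z (overRight (!a) y)) (y ++ [!a] ++ z))).2
  have h4 := (Red.refl [⟨[!a], .cup a, y ++ z⟩]).append h3
  have h5 := (Move.zigzagLeft (!a)).red.within [] (y ++ z) [] (pad [] z (overRight (!a) y))
  simp [cupOver] at h1 h2 h4 h5
  simpa [cupOver] using h1.trans (h2.trans (h4.trans h5))

/-- Closing a strand that passes over a row. -/
theorem overRight_cap (s : Bool) (y : List Bool) :
    pad [] [!s] (overRight s y) ++ [⟨y, .cap s, []⟩] ≈ₜ
      pad [s] [] (overLeft (!s) y) ++ [⟨[], .cap s, y⟩] := by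
  induction y with
  | nil => exact .refl _
  | cons c y ih =>
    have h1 := (ih.pad [c] []).append (.refl [])
    have h2 := (Eqv.refl [⟨[], .cross true s c, y ++ [!s]⟩]).append h1
    have h3 := (exchange_cross true s c (goes_overLeft (!s) y)).append
      (.refl [⟨[c], .cap s, y⟩])
    have h4 := ((Move.slideCap true c s).eqv (by simp))
    have h5 := ((Move.slideCap false c s).eqv (by simp)).symm.within [] y
      (pad [s, c] [] (overLeft (!s) y)) []
    simp at h1 h2 h3 h5
    simpa using h2.trans (h3.trans h5)

/-- Closing an arc with the neighbouring strand on its right end. -/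
theorem cupOver_cap_right (a : Bool) (y z : List Bool) :
    cupOver a y (a :: z) ++ [⟨a :: y, .cap (!a), z⟩] ⇝ pad [] z (overLeft a y) := by
  -- The maximum is pulled back along the arc to the minimum, with which it forms a zigzag.
  have h1 := ((overRight_cap (!a) y).1.within [a] z [⟨[], .cup a, y ++ a :: z⟩] [])
  have h2 := (exchange_cup a (by simpa using goes_pad [] z (goes_overLeft a y) :
    Goes (y ++ a :: z) (pad [] z (overLeft a y)) (a :: y ++ z))).1.append
      (.refl [⟨[a], .cap (!a), y ++ z⟩])
  have h3 := (Move.zigzagRight a).red.within [] (y ++ z) (pad [] z (overLeft a y)) []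
  simp at h1 h2 h3
  simpa [cupOver] using h1.trans (h2.trans h3)

theorem cupOver_snoc_cross (a c : Bool) (y z : List Bool) :
    cupOver a (y ++ [c]) z ++ [⟨a :: y, .cross false c (!a), z⟩] ⇝ cupOver a y (c :: z) := by
  have h := (Move.reidemeisterTwo true (!a) c).red.within (a :: y) z (cupOver a y (c :: z)) []
  simp at h
  simpa [cupOver_append] using h

/-- The last crossing of the arc and the maximum form a curl. -/
theorem cupOver_snoc_cap (a : Bool) (y z : List Bool) :
    cupOver a (y ++ [a]) z ++ [⟨a :: y, .cap a, z⟩] ⇝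
      cupOver a y (a :: z) ++ [⟨a :: y, .cap (!a), z⟩] := by
  have h := (Move.reidemeisterOneCap true (!a)).red.within (a :: y) z (cupOver a y (a :: z)) []
  simp at h
  simpa [cupOver_append] using h

theorem cupOver_nil_cross (v a : Bool) (z : List Bool) :
    cupOver a [] z ++ [⟨[], .cross v a (!a), z⟩] ⇝ cupOver (!a) [] z := by
  have h := (Move.reidemeisterOneCup v a).red.within [] z [] []
  simp at h
  simpa [cupOver] using h

/-! ### Generation by skein relations -/

/-- Tangle words with bottom row `[]` and top row `x` that arise from words in `B` by isotopies and
by completing skein triples. -/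
inductive Gen (B : List Layer → Prop) (x : List Bool) : List Layer → Prop
  | base {w : List Layer} (hw : B w) (hg : Goes [] w x) : Gen B x w
  | iso {w w' : List Layer} (hw : Gen B x w) (h : Iso [] x w w') : Gen B x w'
  | cross {u t : List Layer} {l r : List Bool} (v a b : Bool)
      (h : Gen B x (u ++ [⟨l, .cross (!v) a b, r⟩] ++ t))
      (h₀ : Gen B x (u ++ smoothing a b l r ++ t)) :
      Gen B x (u ++ [⟨l, .cross v a b, r⟩] ++ t)
  | smooth {u t : List Layer} {l r : List Bool} (a b : Bool)
      (h : ∀ v, Gen B x (u ++ [⟨l, .cross v a b, r⟩] ++ t)) :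
      Gen B x (u ++ smoothing a b l r ++ t)

theorem goes_smoothing (a b : Bool) (l r : List Bool) :
    Goes (l ++ a :: b :: r) (smoothing a b l r) (l ++ b :: a :: r) := by
  unfold smoothing
  split_ifs with h
  · simp [h]
  · obtain rfl : b = !a := by cases a <;> cases b <;> simp_all
    simp [Layer.bot, Layer.top, Piece.bot, Piece.top]

theorem goes_change {u s s' t : List Layer} {x y X Y : List Bool} (hs : s ≠ [])
    (h : Goes x s y) (h' : Goes x s' y) (hg : Goes X (u ++ s ++ t) Y) :
    Goes X (u ++ s' ++ t) Y := by
  obtain ⟨m, hm, ht⟩ := goes_append.1 hg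
  obtain ⟨n, hn, hs'⟩ := goes_append.1 hm
  obtain rfl := hs'.bot_unique hs h
  obtain rfl := hs'.top_unique h
  exact (hn.append h').append ht

theorem goes_cross (v a b : Bool) (l r : List Bool) :
    Goes (l ++ a :: b :: r) [⟨l, .cross v a b, r⟩] (l ++ b :: a :: r) := by
  simp [Layer.bot, Layer.top, Piece.bot, Piece.top]

theorem Gen.goes {B : List Layer → Prop} {x : List Bool} {w : List Layer} (h : Gen B x w) :
    Goes [] w x := by
  induction h with
  | base _ hg => exact hg
  | iso _ h _ => exact h.goes_right
  | cross v a b _ _ ih _ =>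
    exact goes_change (by simp) (goes_cross _ _ _ _ _) (goes_cross _ _ _ _ _) ih
  | smooth a b _ ih =>
    exact goes_change (by simp) (goes_cross _ _ _ _ _) (goes_smoothing _ _ _ _) (ih true)

/-- All rules of `Gen` are local, so they persist when `t` is stacked on top; only the generators
have to be checked. -/
theorem Gen.comp {B B' : List Layer → Prop} {x y : List Bool} {w t : List Layer}
    (hw : Gen B x w) (ht : Goes x t y) (h : ∀ b, B b → Goes [] b x → Gen B' y (b ++ t)) :
    Gen B' y (w ++ t) := by
  induction hw with
  | base hw hg => exact h _ hw hg
  | iso _ hi ih =>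
    refine ih.iso ?_
    simpa using hi.context [] [] (u := []) (t := t) (by simp) (by simpa using ht)
  | cross v a b _ _ ih ih₀ =>
    simpa using Gen.cross v a b (by simpa using ih) (by simpa using ih₀)
  | smooth a b _ ih =>
    simpa using Gen.smooth a b (fun v => by simpa using ih v)

theorem Gen.red {B : List Layer → Prop} {x : List Bool} {w w' : List Layer} (hw : Gen B x w)
    (h : w ⇝ w') : Gen B x w' := hw.iso (h _ _ hw.goes)

theorem Gen.of_red {B : List Layer → Prop} {x : List Bool} {w w' : List Layer}
    (hw : Gen B x w') (h : w ⇝ w') (hg : Goes [] w x) : Gen B x w := hw.iso (h _ _ hg).symm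

/-! ### Standard diagrams and the span they generate -/

/-- The standard tangle diagrams: nested arcs, each over all the arcs that are drawn before; closed
components are not needed, except for the round circle. -/
inductive Basic : List Bool → List Layer → Prop
  | nil : Basic [] []
  | unknot : Basic [] OrientedLinks.unknot.word
  | arc {b : List Layer} (a : Bool) (y z : List Bool) (h : Basic (y ++ z) b) :
      Basic (a :: y ++ [!a] ++ z) (b ++ cupOver a y z)

theorem Basic.goes {x : List Bool} {b : List Layer} (h : Basic x b) : Goes [] b x := by
  induction h with
  | nil => rfl
  | unknot => exact OrientedLinks.unknot.goes
  | arc a y z _ ih => exact ih.append (goes_cupOver a y z)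

/-- Tangle words that are generated by the standard diagrams. -/
abbrev Spanned (x : List Bool) (w : List Layer) : Prop := Gen (Basic x) x w

theorem Basic.spanned {x : List Bool} {b : List Layer} (h : Basic x b) : Spanned x b :=
  .base h h.goes

theorem Spanned.arc {w : List Layer} (a : Bool) (y z : List Bool) (h : Spanned (y ++ z) w) :
    Spanned (a :: y ++ [!a] ++ z) (w ++ cupOver a y z) :=
  h.comp (goes_cupOver a y z) fun _ hb _ => (hb.arc a y z).spanned

theorem Spanned.cup_left {x : List Bool} {w : List Layer} (h : Spanned x w) (o : Bool) :
    Spanned (o :: (!o) :: x) (w ++ [⟨[], .cup o, x⟩]) := by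
  simpa [cupOver] using Spanned.arc o [] x h

/-- Layers with fewer than `n` strands at the bottom preserve the span. -/
def ClosedBelow (n : ℕ) : Prop :=
  ∀ (e : Layer) (w : List Layer), e.bot.length < n → Spanned e.bot w → Spanned e.top (w ++ [e])

theorem ClosedBelow.append {n : ℕ} (H : ClosedBelow n) {t : List Layer} {x y : List Bool}
    {w : List Layer} (ht : Goes x t y) (hn : ∀ e ∈ t, e.bot.length < n) (h : Spanned x w) :
    Spanned y (w ++ t) := by
  induction t generalizing x w with
  | nil => cases ht; simpa using h
  | cons e t ih =>
    obtain ⟨rfl, h2⟩ := ht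
    simpa using ih h2 (fun f hf => hn f (by simp [hf])) (H e w (hn e (by simp)) h)

theorem length_bot_pad {n : ℕ} {a b : List Bool} {t : List Layer}
    (h : ∀ e ∈ t, e.bot.length = n) : ∀ e ∈ pad a b t, e.bot.length = a.length + n + b.length := by
  intro e he
  obtain ⟨f, hf, rfl⟩ := List.mem_map.1 he
  rw [← h f hf]
  simp [Layer.bot]
  omega

theorem length_bot_overRight (s : Bool) (y : List Bool) :
    ∀ e ∈ overRight s y, e.bot.length = y.length + 1 := by
  induction y with
  | nil => simp
  | cons c y ih =>
    intro e he
    rcases List.mem_cons.1 he with rfl | he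
    · simp [Layer.bot, Piece.bot]
    · rw [length_bot_pad ih e he]; simp; omega

theorem length_bot_overLeft (s : Bool) (y : List Bool) :
    ∀ e ∈ overLeft s y, e.bot.length = y.length + 1 := by
  induction y with
  | nil => simp
  | cons c y ih =>
    intro e he
    rcases List.mem_append.1 he with he | he
    · rw [length_bot_pad ih e he]; simp; omega
    · obtain rfl := List.mem_singleton.1 he
      simp [Layer.bot, Piece.bot]

/-! ### Circles -/

/-- A figure eight has its crossing in a curl at the minimum and also at the maximum; removing one
or the other gives the two circles. -/
theorem circle_flip (a : Bool) (x : List Bool) :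
    [⟨[], .cup a, x⟩, ⟨[], .cap a, x⟩] ≈ₜ [⟨[], .cup (!a), x⟩, ⟨[], .cap (!a), x⟩] := by
  have h1 := ((Move.reidemeisterOneCup true a).eqv (by simp)).within [] x []
    [⟨[], .cap (!a), x⟩]
  have h2 := ((Move.reidemeisterOneCap true a).eqv (by simp)).within [] x
    [⟨[], .cup a, x⟩] []
  simp at h1 h2
  exact h2.symm.trans h1

/-- A circle beside the strand `c` is what remains when a curl of that strand is smoothed. Both
signs of the curl are isotopic to the bare strand, so `Gen.smooth`, which amounts to division by
`m`, produces the circle. -/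
theorem Gen.circle_cons {B : List Layer → Prop} {c : Bool} {x : List Bool} {w : List Layer}
    (h : Gen B (c :: x) w) (a : Bool) :
    Gen B (c :: x) (w ++ [⟨[], .cup a, c :: x⟩, ⟨[], .cap a, c :: x⟩]) := by
  suffices hc : Gen B (c :: x) (w ++ [⟨[], .cup (!c), c :: x⟩, ⟨[], .cap (!c), c :: x⟩]) by
    by_cases hac : a = !c
    · rwa [hac]
    · obtain rfl : a = c := by cases a <;> cases c <;> simp_all
      exact hc.red ((Red.refl w).append (circle_flip a (a :: x)).2)
  have key : ∀ v, Gen B (c :: x) ((w ++ [⟨[], .cup (!c), c :: x⟩]) ++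
      [⟨[!c], .cross v c c, x⟩] ++ [⟨[], .cap (!c), c :: x⟩]) := by
    intro v
    refine h.of_red ?_ ?_
    · have h1 := (Move.slideCap v c (!c)).red.within [] x (w ++ [⟨[], .cup (!c), c :: x⟩]) []
      have h2 := (Move.reidemeisterOneCup (!v) (!c)).red.within [] (c :: x) w [⟨[c], .cap (!c), x⟩]
      have h3 := (Move.zigzagRight c).red.within [] x w []
      simp at h1 h2 h3
      simpa using h1.trans (h2.trans h3)
    · refine ((h.goes.append ?_).append (goes_cross _ _ _ _ _)).append ?_ <;>
      simp [Layer.bot, Layer.top, Piece.bot, Piece.top]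
  simpa [smoothing] using Gen.smooth c c key

/-- With no open strand to curl, the unknot itself is drawn as a figure eight, whose smoothing
consists of two circles. -/
theorem Gen.circle_unknot {B : List Layer → Prop} (h : Gen B [] unknot.word) (a : Bool) :
    Gen B [] (unknot.word ++ [⟨[], .cup a, []⟩, ⟨[], .cap a, []⟩]) := by
  suffices hc : Gen B [] (unknot.word ++ [⟨[], .cup false, []⟩, ⟨[], .cap false, []⟩]) by
    cases a
    · exact hc
    · exact hc.red ((Red.refl _).append (circle_flip true []).2)
  have key : ∀ v, Gen B [] ([⟨[], .cup true, []⟩] ++ [⟨[], .cross v true false, []⟩] ++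
      [⟨[], .cap false, []⟩]) := by
    intro v
    have h1 := (Move.reidemeisterOneCap v true).red.within [] [] [⟨[], .cup true, []⟩] []
    simp at h1
    refine h.of_red h1 ?_
    simp [Layer.bot, Layer.top, Piece.bot, Piece.top]
  simpa [smoothing, OrientedLinks.unknot] using Gen.smooth true false key

theorem Spanned.circle_basic {x : List Bool} {b : List Layer} (h : Basic x b) (a : Bool) :
    Spanned x (b ++ [⟨[], .cup a, x⟩, ⟨[], .cap a, x⟩]) := by
  cases h with
  | nil =>
    have hu := Basic.unknot.spanned
    cases a
    · exact hu.red (circle_flip true []).1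
    · exact hu
  | unknot => exact Basic.unknot.spanned.circle_unknot a
  | arc a' y z h' => exact (h'.arc a' y z).spanned.circle_cons a

/-! ### Layers preserve the span -/

theorem pair_cases {l r y z : List Bool} {c d s : Bool} (h : l ++ c :: d :: r = y ++ s :: z) :
    (∃ m, y = l ++ c :: d :: m ∧ r = m ++ s :: z) ∨ (∃ m, l = y ++ s :: m ∧ z = m ++ c :: d :: r) ∨
      (y = l ++ [c] ∧ d = s ∧ r = z) ∨ (l = y ∧ c = s ∧ z = d :: r) := by
  rcases List.append_eq_append_iff.1 h with ⟨m, hm, h'⟩ | ⟨m, hm, h'⟩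
  · rcases m with _ | ⟨c', _ | ⟨d', m⟩⟩
    · simp_all
    · simp_all
    · simp_all
  · rcases m with _ | ⟨c', m⟩
    · simp_all
    · simp_all

theorem point_cases {l r y z : List Bool} {s : Bool} (h : l ++ r = y ++ s :: z) :
    (∃ m, y = l ++ m ∧ r = m ++ s :: z) ∨ (∃ m, l = y ++ s :: m ∧ z = m ++ r) := by
  rcases List.append_eq_append_iff.1 h with ⟨m, hm, h'⟩ | ⟨m, hm, h'⟩
  · exact .inl ⟨m, hm, h'⟩
  · rcases m with _ | ⟨c', m⟩
    · exact .inl ⟨[], by simp_all, by simp_all⟩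
    · exact .inr ⟨m, by simp_all⟩

/-- A piece under the last arc slides down through it and then meets two strands fewer, so that `H`
applies; afterwards the arc is drawn again. -/
theorem ClosedBelow.inside {n : ℕ} (H : ClosedBelow n) {b : List Layer} (a : Bool) (l m z : List Bool)
    (p : Piece) (hn : (l ++ p.bot ++ m ++ z).length < n)
    (hb : Spanned (l ++ p.bot ++ m ++ z) b) :
    Spanned (a :: l ++ p.top ++ m ++ [!a] ++ z)
      (b ++ cupOver a (l ++ p.bot ++ m) z ++ [⟨a :: l, p, m ++ (!a) :: z⟩]) := by
  have h0 := H ⟨l, p, m ++ z⟩ b (by simpa [Layer.bot] using hn) (by simpa [Layer.bot] using hb)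
  have h1 := Spanned.arc a (l ++ p.top ++ m) z (by simpa [Layer.top] using h0)
  have h2 := (Eqv.refl b).append (cupOver_natural a (y := l ++ p.bot ++ m)
    (y' := l ++ p.top ++ m) z (t := [⟨l, p, m⟩]) (by simp [Layer.bot, Layer.top]))
  have h3 := h1.red (by simpa using h2.2)
  simpa using h3

theorem ClosedBelow.outside {n : ℕ} (H : ClosedBelow n) {b : List Layer} (a : Bool) (y m r : List Bool)
    (p : Piece) (hn : (y ++ m ++ p.bot ++ r).length < n)
    (hb : Spanned (y ++ m ++ p.bot ++ r) b) :
    Spanned (a :: y ++ [!a] ++ m ++ p.top ++ r)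
      (b ++ cupOver a y (m ++ p.bot ++ r) ++ [⟨a :: y ++ [!a] ++ m, p, r⟩]) := by
  have h0 := H ⟨y ++ m, p, r⟩ b (by simpa [Layer.bot] using hn) (by simpa [Layer.bot] using hb)
  have h1 := Spanned.arc a y (m ++ p.top ++ r) (by simpa [Layer.top] using h0)
  have h2 := (Eqv.refl b).append (cupOver_natural_right a y (z := m ++ p.bot ++ r)
    (z' := m ++ p.top ++ r) (t := [⟨m, p, r⟩]) (by simp [Layer.bot, Layer.top]))
  have h3 := h1.red (by simpa using h2.2)
  simpa using h3

theorem ClosedBelow.cup {n : ℕ} (H : ClosedBelow n) {x l r : List Bool} {b : List Layer} (o : Bool)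
    (hx : x.length ≤ n) (hb : Basic x b) (hl : l ++ r = x) :
    Spanned (l ++ o :: (!o) :: r) (b ++ [⟨l, .cup o, r⟩]) := by
  rcases l with _ | ⟨a', l⟩
  · obtain rfl : r = x := hl
    exact hb.spanned.cup_left o
  · cases hb with
    | nil => cases hl
    | unknot => cases hl
    | @arc b a y z hb =>
      obtain ⟨rfl, hl⟩ : a' = a ∧ l ++ r = y ++ (!a) :: z := by simpa using hl
      rcases point_cases hl with ⟨m, rfl, rfl⟩ | ⟨m, rfl, rfl⟩
      · have := H.inside a' l m z (.cup o) (by simp [Piece.bot] at hx ⊢; omega)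
          (by simpa [Piece.bot] using hb.spanned)
        simpa [Piece.bot, Piece.top] using this
      · have := H.outside a' y m r (.cup o) (by simp [Piece.bot] at hx ⊢; omega)
          (by simpa [Piece.bot] using hb.spanned)
        simpa [Piece.bot, Piece.top] using this

theorem goes_cap_at (o : Bool) (l r : List Bool) :
    Goes (l ++ o :: (!o) :: r) [⟨l, .cap o, r⟩] (l ++ r) := by
  simp [Layer.bot, Layer.top, Piece.bot, Piece.top]

/-- The capped arc is isotopic to a strand running over `y` to the left. Each of its layers has two
strands fewer than the row below the maximum, so `H` absorbs them one at a time. -/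
theorem ClosedBelow.cap_right {n : ℕ} (H : ClosedBelow n) {b : List Layer} (a : Bool) (y z : List Bool)
    (hn : (y ++ a :: z).length < n) (hb : Spanned (y ++ a :: z) b) :
    Spanned (a :: y ++ z) (b ++ cupOver a y (a :: z) ++ [⟨a :: y, .cap (!a), z⟩]) := by
  have h1 : Spanned (a :: y ++ z) (b ++ pad [] z (overLeft a y)) := by
    refine H.append ?_ ?_ hb
    · simpa using goes_pad [] z (goes_overLeft a y)
    · intro e he
      rw [length_bot_pad (length_bot_overLeft a y) e he]
      simp at hn ⊢; omega
  refine h1.of_red ?_ ?_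
  · simpa using (Red.refl b).append (cupOver_cap_right a y z)
  · refine (hb.goes.append (goes_cupOver a y (a :: z))).append ?_
    simpa using goes_cap_at (!a) (a :: y) z

theorem ClosedBelow.cap {n : ℕ} (H : ClosedBelow n) {x l r : List Bool} {b : List Layer} (o : Bool)
    (hx : x.length ≤ n) (hb : Basic x b) (hl : l ++ o :: (!o) :: r = x) :
    Spanned (l ++ r) (b ++ [⟨l, .cap o, r⟩]) := by
  cases hb with
  | nil => simp at hl
  | unknot => simp at hl
  | @arc b a y z hb =>
    rcases l with _ | ⟨a', l⟩
    · obtain ⟨rfl, hl⟩ : o = a ∧ (!o) :: r = y ++ (!a) :: z := by simpa using hl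
      rcases y with _ | ⟨c, y⟩
      · obtain rfl : r = z := by simpa using hl
        -- Both ends of the same arc are joined, which leaves a distant circle.
        simpa [cupOver] using Spanned.circle_basic hb o
      · obtain ⟨rfl, rfl⟩ : (!o) = c ∧ r = y ++ (!o) :: z := by simpa using hl
        have h1 : Spanned (y ++ (!o) :: z) (b ++ pad [] z (overRight (!o) y)) := by
          refine H.append ?_ ?_ hb.spanned
          · simpa using goes_pad [] z (goes_overRight (!o) y)
          · intro e he
            rw [length_bot_pad (length_bot_overRight (!o) y) e he]
            simp at hx ⊢; omega
        refine h1.of_red ?_ ?_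
        · simpa using (Red.refl b).append (cupOver_cap_left o y z)
        · refine ((hb.arc o _ z).goes).append ?_
          simpa using goes_cap_at o [] (y ++ (!o) :: z)
    · obtain ⟨rfl, hl⟩ : a' = a ∧ l ++ o :: (!o) :: r = y ++ (!a) :: z := by simpa using hl
      rcases pair_cases hl with ⟨m, rfl, rfl⟩ | ⟨m, rfl, rfl⟩ | ⟨rfl, h, rfl⟩ | ⟨rfl, rfl, rfl⟩
      · have := H.inside a' l m z (.cap o) (by simp [Piece.bot] at hx ⊢; omega)
          (by simpa [Piece.bot] using hb.spanned)
        simpa [Piece.bot, Piece.top] using this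
      · have := H.outside a' y m r (.cap o) (by simp [Piece.bot] at hx ⊢; omega)
          (by simpa [Piece.bot] using hb.spanned)
        simpa [Piece.bot, Piece.top] using this
      · obtain rfl : o = a' := by simpa using h
        have h1 := H.cap_right o l r (by simp at hx ⊢; omega) (by simpa using hb.spanned)
        refine h1.of_red ?_ ?_
        · simpa using (Red.refl b).append (cupOver_snoc_cap o l r)
        · refine ((hb.arc o _ r).goes).append ?_
          simpa using goes_cap_at o (o :: l) r
      · rw [Bool.not_not] at hb hx ⊢
        simpa using H.cap_right a' l r (by simp at hx ⊢; omega) hb.spanned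

theorem ClosedBelow.smooth {n : ℕ} (H : ClosedBelow n) {x l r : List Bool} {b : List Layer} (c d : Bool)
    (hx : x.length ≤ n) (hb : Basic x b) (hl : l ++ c :: d :: r = x) :
    Spanned (l ++ d :: c :: r) (b ++ smoothing c d l r) := by
  unfold smoothing
  split_ifs with h
  · subst h hl; simpa using hb.spanned
  · obtain rfl : d = !c := by cases c <;> cases d <;> simp_all
    have h1 := H.cap c hx hb hl
    -- The maximum has removed two strands, so the minimum above it is within reach of `H`.
    have h2 := H ⟨l, .cup (!c), r⟩ _ (by simp [Layer.bot, Piece.bot, ← hl] at hx ⊢; omega)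
      (by simpa [Layer.bot, Piece.bot] using h1)
    simpa [Layer.top, Piece.top] using h2

/-- It suffices to treat one of the two crossings. -/
theorem ClosedBelow.cross_of_cross {n : ℕ} (H : ClosedBelow n) {x l r : List Bool} {b : List Layer}
    (c d : Bool) (hx : x.length ≤ n) (hb : Basic x b) (hl : l ++ c :: d :: r = x) (v₀ v : Bool)
    (h : Spanned (l ++ d :: c :: r) (b ++ [⟨l, .cross v₀ c d, r⟩])) :
    Spanned (l ++ d :: c :: r) (b ++ [⟨l, .cross v c d, r⟩]) := by
  by_cases hv : v = v₀
  · rwa [hv]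
  · obtain rfl : v₀ = !v := by cases v <;> cases v₀ <;> simp_all
    simpa using Gen.cross (t := []) v c d (by simpa using h)
      (by simpa using H.smooth c d hx hb hl)

/-- The last two arcs start at neighbouring points, and the crossing exchanges these starts. If
their spans interleave, the crossing can be chosen to cancel one already present, and they become
nested; if they are nested, it can be chosen so that the inner arc becomes the uppermost, and they
interleave. In both cases the result is standard after the two arcs are drawn in the other order. -/
theorem Basic.cross_left {a c : Bool} {y z : List Bool} {b : List Layer}
    (hb : Basic (c :: y ++ z) b) :
    ∃ v, Spanned (c :: a :: y ++ [!a] ++ z)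
      (b ++ cupOver a (c :: y) z ++ [⟨[], .cross v a c, y ++ [!a] ++ z⟩]) := by
  generalize hx : c :: y ++ z = x at hb
  cases hb with
  | nil => simp at hx
  | unknot => simp at hx
  | @arc b c' Y Z hb =>
    obtain ⟨rfl, hx⟩ : c = c' ∧ y ++ z = Y ++ (!c') :: Z := by simpa using hx
    -- The question is whether the arc starting at `c` ends beyond the end of the arc starting at
    -- `a`, or before it.
    rcases point_cases hx with ⟨m, rfl, rfl⟩ | ⟨m, rfl, rfl⟩
    · refine ⟨true, ?_⟩
      have h0 : Basic (a :: y ++ [!a] ++ m ++ Z) (b ++ cupOver a y (m ++ Z)) := by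
        simpa using Basic.arc a y (m ++ Z) (by simpa using hb)
      have h1 := (h0.arc c (a :: y ++ [!a] ++ m) Z).spanned
      simp at h1
      have h2 := (cupOver_natural c Z (goes_cupOver a y m)).2
      have h3 := ((Red.refl b).append h2)
      have h4 := (cupOver_cons_cancel a c y (m ++ (!c) :: Z))
      have h5 := ((Red.refl (b ++ cupOver c (y ++ m) Z)).append h4)
      simp [pad_cupOver] at h3
      have h6 : pad [c] ((!c) :: Z) (cupOver a y m) = pad [c] [] (cupOver a y (m ++ (!c) :: Z)) := by
        rw [← pad_cupOver, pad_pad]; simp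
      rw [h6] at h3
      simp at h3 h5
      refine (h1.red (h3.trans ?_)).of_red (w := _) (w' := b ++ (cupOver c (y ++ m) Z ++
        pad [c] [] (cupOver a y (m ++ (!c) :: Z)))) ?_ ?_ |> fun h => by simpa using h
      · exact .refl _
      · exact h5
      · have g1 : Goes [] (b ++ cupOver c (y ++ m) Z) (c :: y ++ (m ++ (!c) :: Z)) := by
          simpa using (hb.arc c _ Z).goes
        have g2 := goes_cupOver a (c :: y) (m ++ (!c) :: Z)
        have g3 := goes_cross true a c [] (y ++ [!a] ++ (m ++ (!c) :: Z))
        simpa using (g1.append g2).append (by simpa using g3)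
    · refine ⟨false, ?_⟩
      have h0 : Basic (a :: Y ++ (m ++ [!a] ++ z)) (b ++ cupOver a (Y ++ m) z) := by
        simpa using Basic.arc a (Y ++ m) z (by simpa using hb)
      have h1 := (h0.arc c (a :: Y) (m ++ [!a] ++ z)).spanned
      have h2 := (Red.refl (b ++ cupOver a (Y ++ m) z)).append
        (cupOver_cross_left a c Y (m ++ [!a] ++ z)).2
      have h3 := (cupOver_natural a z (goes_cupOver c Y m)).1
      have h4 := ((Red.refl b).append h3).append
        (.refl [⟨[], .cross false a c, Y ++ [!c] ++ (m ++ [!a] ++ z)⟩])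
      have h6 : pad [a] ((!a) :: z) (cupOver c Y m) = pad [a] [] (cupOver c Y (m ++ (!a) :: z)) := by
        rw [← pad_cupOver, pad_pad]; simp
      rw [h6] at h4
      simp [pad_cupOver] at h1 h2 h4
      simpa using (h1.red h2).red h4

/-- A crossing away from the ends of the last arc slides below it. At one end, the sign may be
chosen by `cross_of_cross` so that the arc is merely lengthened, shortened or reordered; between its
two ends, the crossing is a curl. -/
theorem ClosedBelow.cross {n : ℕ} (H : ClosedBelow n) {x l r : List Bool} {b : List Layer} (v c d : Bool)
    (hx : x.length ≤ n) (hb : Basic x b) (hl : l ++ c :: d :: r = x) :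
    Spanned (l ++ d :: c :: r) (b ++ [⟨l, .cross v c d, r⟩]) := by
  have hb' := hb
  cases hb with
  | nil => simp at hl
  | unknot => simp at hl
  | @arc b a y z hb =>
    have hr := fun v₀ => H.cross_of_cross c d hx hb' hl v₀ v
    rcases l with _ | ⟨a', l⟩
    · obtain ⟨rfl, hl⟩ : c = a ∧ d :: r = y ++ (!a) :: z := by simpa using hl
      rcases y with _ | ⟨c', y⟩
      · obtain ⟨rfl, rfl⟩ : d = !c ∧ r = z := by simpa using hl
        refine (Spanned.arc (!c) [] r hb.spanned |> fun h => h.of_red ?_ ?_ |> fun h => by simpa using h)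
        · simpa using (Red.refl b).append (cupOver_nil_cross v c r)
        · have := hb'.goes.append (goes_cross v c (!c) [] r)
          simpa using this
      · obtain ⟨rfl, rfl⟩ : d = c' ∧ r = y ++ (!c) :: z := by simpa using hl
        obtain ⟨v₀, h⟩ := hb.cross_left (a := c)
        exact hr v₀ (by simpa using h)
    · obtain ⟨rfl, hl⟩ : a' = a ∧ l ++ c :: d :: r = y ++ (!a) :: z := by simpa using hl
      rcases pair_cases hl with ⟨m, rfl, rfl⟩ | ⟨m, rfl, rfl⟩ | ⟨rfl, rfl, rfl⟩ | ⟨rfl, rfl, rfl⟩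
      · have := H.inside a' l m z (.cross v c d) (by simp [Piece.bot] at hx ⊢; omega)
          (by simpa [Piece.bot] using hb.spanned)
        simpa [Piece.bot, Piece.top] using this
      · have := H.outside a' y m r (.cross v c d) (by simp [Piece.bot] at hx ⊢; omega)
          (by simpa [Piece.bot] using hb.spanned)
        simpa [Piece.bot, Piece.top] using this
      -- With this sign the arc crosses back over `c`, which undoes its last crossing.
      · refine hr false ?_
        have h1 := Spanned.arc a' l (c :: r) (by simpa using hb.spanned)
        refine (h1.of_red ?_ ?_ |> fun h => by simpa using h)
        · simpa using (Red.refl b).append (cupOver_snoc_cross a' c l r)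
        · have g := goes_cross false c (!a') (a' :: l) r
          have := hb'.goes.append (w' := [⟨a' :: l, .cross false c (!a'), r⟩])
            (z := a' :: l ++ (!a') :: c :: r) (by simpa [-goes_cons] using g)
          simpa using this
      -- With this sign the arc goes on over `d`, so the diagram is already standard.
      · refine hr true ?_
        have h1 := Spanned.arc a' (l ++ [d]) r (by simpa using hb.spanned)
        simpa [cupOver_append] using h1

/-- Induction on the number of strands; `Gen.comp` reduces each new layer to the case of a standard
diagram below it. -/
theorem closedBelow (n : ℕ) : ClosedBelow n := by
  induction n with
  | zero => intro e w h; simp at h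
  | succ n H =>
    rintro ⟨l, p, r⟩ w hn hw
    refine hw.comp ⟨rfl, rfl⟩ fun b hb _ => ?_
    have hn' := Nat.le_of_lt_succ hn
    cases p with
    | cup o =>
      have := H.cup o hn' hb (l := l) (r := r) (by simp [Layer.bot, Piece.bot])
      simpa [-Bool.forall_bool, Layer.top, Piece.top] using this
    | cap o =>
      have := H.cap o hn' hb (l := l) (r := r) (by simp [Layer.bot, Piece.bot])
      simpa [-Bool.forall_bool, Layer.top, Piece.top] using this
    | cross v c d =>
      have := H.cross v c d hn' hb (l := l) (r := r) (by simp [Layer.bot, Piece.bot])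
      simpa [-Bool.forall_bool, Layer.top, Piece.top] using this

/-! ### Single generators for links and for one-strand tangles -/

/-- Every tangle diagram without end points at the bottom is generated by the standard ones. -/
theorem spanned_of_goes {x : List Bool} {w : List Layer} (h : Goes [] w x) : Spanned x w := by
  have key := (closedBelow ((w.map fun e => e.bot.length).sum + 1)).append h
    (fun e he => Nat.lt_succ_of_le (List.single_le_sum (by simp) _ (List.mem_map_of_mem he)))
    Basic.nil.spanned
  simpa using key

theorem Basic.eq_of_pair {o : Bool} {b : List Layer} (h : Basic [o, !o] b) :
    b = [⟨[], .cup o, []⟩] ∨ b = OrientedLinks.unknot.word ++ [⟨[], .cup o, []⟩] := by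
  generalize hx : [o, !o] = x at h
  cases h with
  | nil => simp at hx
  | unknot => simp at hx
  | @arc b a y z hb =>
    rcases y with _ | ⟨c, y⟩
    · obtain ⟨rfl, rfl⟩ : o = a ∧ z = [] := by simpa using hx
      generalize hx' : ([] : List Bool) ++ [] = x at hb
      cases hb with
      | nil => simp [cupOver]
      | unknot => simp [cupOver]
      | arc => simp at hx'
    · simp at hx

/-- The only standard diagrams of this shape are a minimum and a minimum with a distant circle; the
circle is absorbed by `Gen.circle_cons`. -/
theorem gen_cup {o : Bool} {w : List Layer} (h : Goes [] w [o, !o]) :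
    Gen (· = [⟨[], .cup o, []⟩]) [o, !o] w := by
  have hs := (spanned_of_goes h).comp (B' := (· = [⟨[], .cup o, []⟩])) (t := []) rfl
    fun b hb _ => ?_
  · simpa using hs
  · have h0 : Gen (· = [⟨[], .cup o, []⟩]) [o, !o] [⟨[], .cup o, []⟩] :=
      .base rfl (by simp [Layer.bot, Layer.top, Piece.bot, Piece.top])
    rcases hb.eq_of_pair with rfl | rfl
    · simpa using h0
    · have h1 := h0.circle_cons true
      have h2 := exchange_words unknot.goes (y := []) (y' := [o, !o]) (t := [⟨[], .cup o, []⟩])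
        (by simp [Layer.bot, Layer.top, Piece.bot, Piece.top])
      refine h1.red (Red.trans ?_ (h2.2.trans (.of_eq (by simp))))
      exact .of_eq (by simp [unknot])

/-- The top layer of a closed diagram can only be a maximum. Below it is a tangle covered by
`gen_cup`, and capping its generator gives a circle. -/
theorem gen_unknot {w : List Layer} (h : Goes [] w []) (hw : w ≠ []) :
    Gen (· = unknot.word) [] w := by
  obtain ⟨w, ⟨l, p, r⟩, rfl⟩ := (List.eq_nil_or_concat w).resolve_left hw
  rw [List.concat_eq_append] at h ⊢
  obtain ⟨m, hm, rfl, he⟩ := goes_append.1 h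
  have h0 : Gen (· = unknot.word) [] unknot.word := .base rfl unknot.goes
  cases p with
  | cup o => simp [Layer.top, Piece.top] at he
  | cross v a b => simp [Layer.top, Piece.top] at he
  | cap o =>
    obtain ⟨rfl, rfl⟩ : l = [] ∧ r = [] := by simpa [Layer.top, Piece.top] using he
    refine (gen_cup hm).comp (by simp [Layer.bot, Layer.top, Piece.bot, Piece.top]) ?_
    rintro _ rfl -
    cases o
    · exact h0.red (circle_flip true []).1
    · exact h0

/-! ### Skein functions -/

/-- The variable `l`. -/
noncomputable abbrev varL : LaurentLM := LaurentPolynomial.C (LaurentPolynomial.T 1)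

/-- The inverse of the variable `l`. -/
noncomputable abbrev varLInv : LaurentLM := LaurentPolynomial.C (LaurentPolynomial.T (-1))

/-- The variable `m`. -/
noncomputable abbrev varM : LaurentLM := LaurentPolynomial.T 1

/-- The inverse of the variable `m`. -/
noncomputable abbrev varMInv : LaurentLM := LaurentPolynomial.T (-1)

theorem varL_mul_inv : varL * varLInv = 1 := by
  rw [← map_mul, ← LaurentPolynomial.T_add]; simp

theorem varM_mul_inv : varM * varMInv = 1 := by
  rw [← LaurentPolynomial.T_add]; simp

/-- A function on tangle words without end points at the bottom that is invariant under isotopies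
and satisfies the skein relation, with the variables specialized by `φ`. -/
structure IsSkein {K : Type} [CommRing K] (φ : LaurentLM →+* K) (x : List Bool)
    (f : List Layer → K) : Prop where
  step : ∀ w w', TangleStep [] x w w' → f w = f w'
  skein : ∀ (u t : List Layer) (l r : List Bool) (vp vm a b : Bool),
    isPositive vp a b = true → isPositive vm a b = false →
    Goes [] (u ++ [⟨l, .cross vp a b, r⟩] ++ t) x →
    φ varL * f (u ++ [⟨l, .cross vp a b, r⟩] ++ t) +
      φ varLInv * f (u ++ [⟨l, .cross vm a b, r⟩] ++ t) +
      φ varM * f (u ++ smoothing a b l r ++ t) = 0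

theorem IsSkein.iso {K : Type} [CommRing K] {φ : LaurentLM →+* K} {x : List Bool}
    {f : List Layer → K} (hf : IsSkein φ x f) {w w' : List Layer} (h : Iso [] x w w') :
    f w = f w' := by
  obtain ⟨-, h⟩ := h
  induction h with
  | rel _ _ h => exact hf.step _ _ h
  | refl => rfl
  | symm _ _ _ ih => exact ih.symm
  | trans _ _ _ _ _ ih ih' => exact ih.trans ih'

theorem map_skein_solution {R K : Type} [CommRing R] [CommRing K] (φ : R →+* K)
    (x y z p q : R) : φ (-(x * (y * p + z * q))) = -(φ x * (φ y * φ p + φ z * φ q)) := by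
  simp

/-- The coefficient is read off from the derivation by solving the skein relation for the missing
term. It is computed before specialization, so one `p` serves all `K`, `φ` and `f`. -/
theorem Gen.exists_eval {x : List Bool} {b w : List Layer} (h : Gen (· = b) x w) :
    ∃ p : LaurentLM, ∀ (K : Type) [CommRing K] (φ : LaurentLM →+* K) (f : List Layer → K),
      IsSkein φ x f → f w = φ p * f b := by
  induction h with
  | base hw _ => exact ⟨1, fun K _ φ f _ => by rw [hw]; simp⟩
  | iso _ h ih =>
    obtain ⟨p, hp⟩ := ih
    exact ⟨p, fun K _ φ f hf => by rw [← hf.iso h, hp K φ f hf]⟩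
  | @cross u t l r v c d hw h₀ ih ih₀ =>
    obtain ⟨p, hp⟩ := ih
    obtain ⟨p₀, hp₀⟩ := ih₀
    by_cases hv : isPositive v c d = true
    · refine ⟨-(varLInv * (varLInv * p + varM * p₀)), fun K _ φ f hf => ?_⟩
      have hg := goes_change (s' := [⟨l, .cross v c d, r⟩]) (by simp) (goes_cross _ _ _ _ _)
        (goes_cross _ _ _ _ _) hw.goes
      have h1 := hf.skein u t l r v (!v) c d hv
        (by cases v <;> cases c <;> cases d <;> simp_all [isPositive]) hg
      rw [hp K φ f hf, hp₀ K φ f hf] at h1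
      have h2 : φ varL * φ varLInv = 1 := by rw [← map_mul, varL_mul_inv, map_one]
      rw [map_skein_solution φ]
      linear_combination φ varLInv * h1 - f (u ++ [⟨l, .cross v c d, r⟩] ++ t) * h2
    · refine ⟨-(varL * (varL * p + varM * p₀)), fun K _ φ f hf => ?_⟩
      have h1 := hf.skein u t l r (!v) v c d
        (by cases v <;> cases c <;> cases d <;> simp_all [isPositive]) (by simpa using hv) hw.goes
      rw [hp K φ f hf, hp₀ K φ f hf] at h1
      have h2 : φ varL * φ varLInv = 1 := by rw [← map_mul, varL_mul_inv, map_one]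
      rw [map_skein_solution φ]
      linear_combination φ varL * h1 - f (u ++ [⟨l, .cross v c d, r⟩] ++ t) * h2
  | @smooth u t l r c d hw ih =>
    obtain ⟨p, hp⟩ := ih (c == d)
    obtain ⟨q, hq⟩ := ih !(c == d)
    refine ⟨-(varMInv * (varL * p + varLInv * q)), fun K _ φ f hf => ?_⟩
    have h1 := hf.skein u t l r (c == d) (!(c == d)) c d
      (by simp [isPositive]) (by simp [isPositive]) (hw _).goes
    rw [hp K φ f hf, hq K φ f hf] at h1
    have h2 : φ varM * φ varMInv = 1 := by rw [← map_mul, varM_mul_inv, map_one]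
    rw [map_skein_solution φ]
    linear_combination φ varMInv * h1 - f (u ++ smoothing c d l r ++ t) * h2

theorem pad_smoothing (a b : List Bool) (c d : Bool) (l r : List Bool) :
    pad a b (smoothing c d l r) = smoothing c d (a ++ l) (r ++ b) := by
  unfold smoothing; split_ifs <;> simp

/-- Inserting tangles into a fixed diagram. -/
theorem IsSkein.context {K : Type} [CommRing K] {φ : LaurentLM →+* K} {x y a b : List Bool}
    {f : List Layer → K} (hf : IsSkein φ y f) {u t : List Layer} (hu : Goes [] u (a ++ b))
    (ht : Goes (a ++ x ++ b) t y) : IsSkein φ x fun w => f (u ++ pad a b w ++ t) := by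
  have hg : ∀ {w}, Goes [] w x → Goes [] (u ++ pad a b w ++ t) y := fun hw =>
    (hu.append (by simpa using goes_pad a b hw)).append ht
  refine ⟨?_, ?_⟩
  · rintro _ _ ⟨h1, h2, u', t', p, q, a', b', hm, rfl, rfl⟩
    exact hf.step _ _ ⟨hg h1, hg h2,
      u ++ pad a b u', pad a b t' ++ t, p, q, a ++ a', b' ++ b, hm, by simp, by simp⟩
  · intro u' t' l r vp vm c d hp hm h
    have := hf.skein (u ++ pad a b u') (pad a b t' ++ t) (a ++ l) (r ++ b) vp vm c d hp hm
      (by simpa using hg h)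
    simpa [pad_smoothing] using this

/-! ### The value forced by the skein relation, and uniqueness -/

/-- The value of the HOMFLY polynomial, computed by some resolution of the diagram. -/
noncomputable def LinkDiagram.eval (L : LinkDiagram) : LaurentLM :=
  (gen_unknot L.goes L.ne_nil).exists_eval.choose

theorem LinkDiagram.eval_spec (L : LinkDiagram) {K : Type} [CommRing K] {φ : LaurentLM →+* K}
    {f : List Layer → K} (hf : IsSkein φ [] f) : f L.word = φ L.eval * f unknot.word :=
  (gen_unknot L.goes L.ne_nil).exists_eval.choose_spec K φ f hf

open Classical in
/-- A function on link diagrams as a function on words. -/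
noncomputable def onWords {K : Type} [Zero K] (P : LinkDiagram → K) (w : List Layer) : K :=
  -- The default value does no harm: no local move joins a closed nonempty word to the empty one.
  if h : w ≠ [] ∧ Goes [] w [] then P ⟨w, h.1, h.2⟩ else 0

theorem onWords_word {K : Type} [Zero K] (P : LinkDiagram → K) (L : LinkDiagram) :
    onWords P L.word = P L := dif_pos ⟨L.ne_nil, L.goes⟩

/-- A move that ends in the empty word needs strands at its bottom, and a closed diagram consisting
of that move alone has none. -/
theorem TangleStep.ne_nil {w w' : List Layer} (h : TangleStep [] [] w w') : w ≠ [] ∧ w' ≠ [] := by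
  obtain ⟨h1, h2, u, t, p, q, a, b, hm, rfl, rfl⟩ := h
  have hp := pad_ne_nil (a := a) (b := b) hm.ne_nil
  refine ⟨by simp [hp], fun h => ?_⟩
  simp only [List.append_eq_nil_iff] at h
  obtain ⟨⟨rfl, hq⟩, rfl⟩ := h
  have hq' : q = [] := by simpa [pad] using hq
  subst hq'
  simp only [List.nil_append, List.append_nil] at h1
  obtain ⟨x, y, e1, -, h3⟩ := goes_pad_inv_of_ne_nil hm.ne_nil h1
  obtain ⟨-, rfl, -⟩ : a = [] ∧ x = [] ∧ b = [] := by simpa using e1.symm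
  generalize hq' : ([] : List Layer) = q at hm
  cases hm <;> simp [Layer.bot, Piece.bot] at h3 hq'

theorem IsHomfly.isSkein {P : LinkDiagram → LaurentLM} (hP : IsHomfly P) :
    IsSkein (RingHom.id _) [] (onWords P) := by
  refine ⟨fun w w' h => ?_, fun u t l r vp vm a b hp hm hg => ?_⟩
  · have hn := h.ne_nil
    have h1 := hP.invariant ⟨w, hn.1, h.1⟩ ⟨w', hn.2, h.2.1⟩ (.rel _ _ ?_)
    · rw [← onWords_word P, ← onWords_word P] at h1
      exact h1
    · obtain ⟨-, -, u, t, p, q, a, b, hm, h3, h4⟩ := h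
      exact ⟨u, t, p, q, a, b, hm, h3, h4⟩
  · have hg' := goes_change (by simp) (goes_cross _ _ _ _ _) (goes_cross vm a b l r) hg
    have hz := goes_change (by simp) (goes_cross _ _ _ _ _) (goes_smoothing a b l r) hg
    have hn : u ++ smoothing a b l r ++ t ≠ [] := by
      intro hn
      simp only [List.append_eq_nil_iff] at hn
      obtain ⟨⟨rfl, hs⟩, rfl⟩ := hn
      have := hg.1
      simp [Layer.bot, Piece.bot] at this
    have h1 := hP.skein ⟨_, by simp, hg⟩ ⟨_, by simp, hg'⟩ ⟨_, hn, hz⟩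
      ⟨u, t, l, r, vp, vm, a, b, hp, hm, rfl, rfl, rfl⟩
    rw [← onWords_word P, ← onWords_word P, ← onWords_word P] at h1
    exact h1

theorem IsHomfly.eq_eval {P : LinkDiagram → LaurentLM} (hP : IsHomfly P) (L : LinkDiagram) :
    P L = L.eval := by
  have := L.eval_spec hP.isSkein
  rwa [onWords_word, onWords_word, hP.normalization, mul_one] at this

/-! ### State sums -/

section StateSum

variable {C : Type} [LinearOrder C] {K : Type} [CommRing K]

/-- The order of the colours, or its reverse. -/
def ColorRel (e b : Bool) (i j : C) : Prop := if e = b then i < j else j < i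

instance (e b : Bool) (i j : C) : Decidable (ColorRel e b i j) := by
  unfold ColorRel; infer_instance

theorem colorRel_swap (e b : Bool) (i j : C) : ColorRel e (!b) i j ↔ ColorRel e b j i := by
  cases e <;> cases b <;> simp [ColorRel]

theorem colorRel_not_left (e b : Bool) (i j : C) : ColorRel (!e) b i j ↔ ColorRel e b j i := by
  cases e <;> cases b <;> simp [ColorRel]

theorem colorRel_irrefl (e b : Bool) (i : C) : ¬ ColorRel e b i i := by
  cases e <;> cases b <;> simp [ColorRel]

theorem ColorRel.trans {e b : Bool} {i j k : C} (h : ColorRel e b i j) (h' : ColorRel e b j k) :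
    ColorRel e b i k := by
  unfold ColorRel at *; split_ifs at * <;> order

theorem ColorRel.asymm {e b : Bool} {i j : C} (h : ColorRel e b i j) : ¬ ColorRel e b j i :=
  fun h' => colorRel_irrefl e b i (h.trans h')

theorem colorRel_trichotomy (e b : Bool) (i j : C) :
    ColorRel e b i j ∨ i = j ∨ ColorRel e b j i := by
  unfold ColorRel
  split_ifs
  · exact lt_trichotomy i j
  · rcases lt_trichotomy i j with h | h | h <;> simp [h]

variable [Fintype C]

variable (C K) in
/-- The weights of a state sum: `Q` for a crossing of two strands of the same colour, `α` for a
framing correction, and the weights of minima and maxima. -/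
structure Weights where
  Q : Bool → K
  α : Bool → K
  cupW : Bool → C → K
  capW : Bool → C → K
  Q_mul : ∀ e, Q e * Q (!e) = 1
  α_mul : ∀ e, α e * α (!e) = 1
  cap_mul_cup : ∀ b i, capW (!b) i * cupW b i = 1
  curl : ∀ e b i, α e * (Q e * (cupW b i * capW b i) +
    (Q e - Q (!e)) * ∑ k, if ColorRel e b i k then cupW b k * capW b k else 0) = 1

variable (W : Weights C K)

variable (C K) in
/-- Functions of the colours of an infinite row of strands. -/
abbrev StateFun := Stream' C → K

open Stream' in
/-- The operator of a minimum. -/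
def cupOp (o : Bool) : Module.End K (StateFun C K) where
  -- Operators take functions of the colours above a piece to functions of the colours below it, so
  -- a product of operators reads a word from bottom to top. Infinite rows let all widths share one
  -- algebra; vertical strands on the right then cost nothing.
  toFun f s := ∑ i, W.cupW o i * f (cons i (cons i s))
  map_add' f g := by ext s; simp [mul_add, Finset.sum_add_distrib]
  map_smul' c f := by ext s; simp [Finset.mul_sum, mul_left_comm]

open Stream' in
/-- The operator of a maximum. -/
def capOp (o : Bool) : Module.End K (StateFun C K) where
  toFun f s := if s.head = s.tail.head then W.capW o s.head * f s.tail.tail else 0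
  map_add' f g := by ext s; simp only [Pi.add_apply]; split_ifs <;> ring
  map_smul' c f := by
    ext s; simp only [Pi.smul_apply, smul_eq_mul, RingHom.id_apply]; split_ifs <;> ring

open Stream' in
/-- The operator of a crossing of parallel strands. -/
def parOp (e b : Bool) : Module.End K (StateFun C K) where
  -- This is the Hecke type `R`-matrix: colours are exchanged, and for one order of two distinct
  -- colours there is an extra term that keeps them.
  toFun f s := W.α e *
    ((if s.head = s.tail.head then W.Q e else 1) *
        f (cons s.tail.head (cons s.head s.tail.tail)) +
      if ColorRel e b s.head s.tail.head then (W.Q e - W.Q (!e)) * f s else 0)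
  map_add' f g := by ext s; simp only [Pi.add_apply]; split_ifs <;> ring
  map_smul' c f := by
    ext s; simp only [Pi.smul_apply, smul_eq_mul, RingHom.id_apply]; split_ifs <;> ring

open Stream' in
/-- The operator of a crossing of antiparallel strands. -/
def antiOp (e b : Bool) : Module.End K (StateFun C K) where
  -- This is the same `R`-matrix turned by a right angle: the extra term now consists of a maximum
  -- of one colour below a minimum of another.
  toFun f s := W.α e *
    ((if s.head = s.tail.head then W.Q e else 1) *
        f (cons s.tail.head (cons s.head s.tail.tail)) +
      if s.head = s.tail.head then (W.Q e - W.Q (!e)) * W.capW (!b) s.head *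
        ∑ k, (if ColorRel e b s.head k then W.cupW b k else 0) * f (cons k (cons k s.tail.tail))
      else 0)
  map_add' f g := by
    ext s; simp only [Pi.add_apply, mul_add, Finset.sum_add_distrib]; split_ifs <;> ring
  map_smul' c f := by
    ext s
    simp only [Pi.smul_apply, smul_eq_mul, RingHom.id_apply, mul_left_comm _ c, ← Finset.mul_sum]
    split_ifs <;> ring

/-- The operator of a crossing. -/
def crossOp (v a b : Bool) : Module.End K (StateFun C K) :=
  if a = b then parOp W (isPositive v a b) b else antiOp W (isPositive v a b) b

/-- The operator of a piece. -/
def pieceOp : Piece → Module.End K (StateFun C K)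
  | .cup o => cupOp W o
  | .cap o => capOp W o
  | .cross v a b => crossOp W v a b

open Stream' in
/-- Adding a strand on the left. -/
def shift : Module.End K (StateFun C K) →* Module.End K (StateFun C K) where
  toFun T :=
    { toFun f s := T (fun s' => f (cons s.head s')) s.tail
      map_add' f g := by ext s; exact congrFun (T.map_add _ _) _
      map_smul' c f := by ext s; exact congrFun (T.map_smul _ _) _ }
  map_one' := by ext f s; simp [Stream'.eta]
  map_mul' S T := by ext f s; rfl

section Apply
open Stream'

@[simp] theorem cupOp_apply (o : Bool) (f : StateFun C K) (s : Stream' C) :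
    cupOp W o f s = ∑ i, W.cupW o i * f (cons i (cons i s)) := rfl

@[simp] theorem capOp_apply (o : Bool) (f : StateFun C K) (i j : C) (s : Stream' C) :
    capOp W o f (cons i (cons j s)) = if i = j then W.capW o i * f s else 0 := rfl

@[simp] theorem parOp_apply (e b : Bool) (f : StateFun C K) (i j : C) (s : Stream' C) :
    parOp W e b f (cons i (cons j s)) = W.α e *
      ((if i = j then W.Q e else 1) * f (cons j (cons i s)) +
        if ColorRel e b i j then (W.Q e - W.Q (!e)) * f (cons i (cons j s)) else 0) := rfl

@[simp] theorem antiOp_apply (e b : Bool) (f : StateFun C K) (i j : C) (s : Stream' C) :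
    antiOp W e b f (cons i (cons j s)) = W.α e *
      ((if i = j then W.Q e else 1) * f (cons j (cons i s)) +
        if i = j then (W.Q e - W.Q (!e)) * W.capW (!b) i *
          ∑ k, (if ColorRel e b i k then W.cupW b k else 0) * f (cons k (cons k s))
        else 0) := rfl

omit [LinearOrder C] [Fintype C] in
@[simp] theorem shift_apply (T : Module.End K (StateFun C K)) (f : StateFun C K) (i : C)
    (s : Stream' C) : shift T f (cons i s) = T (fun s' => f (cons i s')) s := rfl

omit [LinearOrder C] [Fintype C] in
theorem op_ext_one {S T : Module.End K (StateFun C K)}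
    (h : ∀ f i s, S f (cons i s) = T f (cons i s)) : S = T := by
  ext f s
  rw [← Stream'.eta s]; exact h _ _ _

omit [LinearOrder C] [Fintype C] in
theorem op_ext_two {S T : Module.End K (StateFun C K)}
    (h : ∀ f i j s, S f (cons i (cons j s)) = T f (cons i (cons j s))) : S = T :=
  op_ext_one fun f i s => by rw [← Stream'.eta s]; exact h _ _ _ _

omit [LinearOrder C] [Fintype C] in
theorem op_ext_three {S T : Module.End K (StateFun C K)}
    (h : ∀ f i j k s, S f (cons i (cons j (cons k s))) = T f (cons i (cons j (cons k s)))) :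
    S = T :=
  op_ext_two fun f i j s => by rw [← Stream'.eta s]; exact h _ _ _ _ _

end Apply

/-! ### Exchange -/

theorem cupOp_mul_shift (o : Bool) (T : Module.End K (StateFun C K)) :
    cupOp W o * shift (shift T) = T * cupOp W o := by
  ext f s
  have : (cupOp W o f : StateFun C K) =
      ∑ i, W.cupW o i • fun s' => f (Stream'.cons i (Stream'.cons i s')) := by
    ext s; simp
  simp [this]

theorem capOp_mul (o : Bool) (T : Module.End K (StateFun C K)) :
    capOp W o * T = shift (shift T) * capOp W o := by
  refine op_ext_two fun f i j s => ?_
  simp only [Module.End.mul_apply, capOp_apply, shift_apply]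
  split_ifs with h
  · exact (congrFun (T.map_smul (W.capW o i) f) s).symm
  · exact (congrFun T.map_zero s).symm

/-- With the two colours fixed, the operator is a linear combination of slices of `f`, and `T` is
linear. -/
theorem parOp_mul_shift (e b : Bool) (T : Module.End K (StateFun C K)) :
    parOp W e b * shift (shift T) = shift (shift T) * parOp W e b := by
  refine op_ext_two fun f i j s => ?_
  simp only [Module.End.mul_apply, parOp_apply, shift_apply]
  have : (fun s' => W.α e *
      ((if i = j then W.Q e else 1) * f (Stream'.cons j (Stream'.cons i s')) +
        if ColorRel e b i j then (W.Q e - W.Q (!e)) * f (Stream'.cons i (Stream'.cons j s')) else 0)) =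
      W.α e • ((if i = j then W.Q e else 1) • (fun s' => f (Stream'.cons j (Stream'.cons i s'))) +
        (if ColorRel e b i j then W.Q e - W.Q (!e) else 0) •
          fun s' => f (Stream'.cons i (Stream'.cons j s'))) := by
    ext s
    simp only [Pi.smul_apply, Pi.add_apply, smul_eq_mul, ite_mul, zero_mul]
  rw [this]
  simp only [map_smul, map_add, Pi.smul_apply, Pi.add_apply, smul_eq_mul, ite_mul, zero_mul]

theorem antiOp_mul_shift (e b : Bool) (T : Module.End K (StateFun C K)) :
    antiOp W e b * shift (shift T) = shift (shift T) * antiOp W e b := by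
  refine op_ext_two fun f i j s => ?_
  simp only [Module.End.mul_apply, antiOp_apply, shift_apply]
  have : (fun s' => W.α e *
      ((if i = j then W.Q e else 1) * f (Stream'.cons j (Stream'.cons i s')) +
        if i = j then (W.Q e - W.Q (!e)) * W.capW (!b) i *
          ∑ k, (if ColorRel e b i k then W.cupW b k else 0) * f (Stream'.cons k (Stream'.cons k s'))
        else 0)) =
      W.α e • ((if i = j then W.Q e else 1) • (fun s' => f (Stream'.cons j (Stream'.cons i s'))) +
        (if i = j then (W.Q e - W.Q (!e)) * W.capW (!b) i else 0) •
          ∑ k, (if ColorRel e b i k then W.cupW b k else 0) •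
            fun s' => f (Stream'.cons k (Stream'.cons k s'))) := by
    ext s
    simp only [Pi.smul_apply, Pi.add_apply, Finset.sum_apply, smul_eq_mul, ite_mul, zero_mul]
  rw [this]
  simp only [map_smul, map_add, map_sum, Pi.smul_apply, Pi.add_apply, Finset.sum_apply,
    smul_eq_mul, ite_mul, zero_mul]

theorem crossOp_mul_shift (v a b : Bool) (T : Module.End K (StateFun C K)) :
    crossOp W v a b * shift (shift T) = shift (shift T) * crossOp W v a b := by
  unfold crossOp
  split_ifs
  · exact parOp_mul_shift ..
  · exact antiOp_mul_shift ..

theorem pieceOp_mul_shift (p : Piece) (T : Module.End K (StateFun C K)) :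
    pieceOp W p * shift^[p.top.length] T = shift^[p.bot.length] T * pieceOp W p := by
  cases p with
  | cup o => exact cupOp_mul_shift W o T
  | cap o => exact capOp_mul W o T
  | cross v a b => exact crossOp_mul_shift W v a b T

/-! ### Planar isotopies and the first two Reidemeister moves -/

theorem Weights.cup_mul_cap (b : Bool) (i : C) : W.cupW b i * W.capW (!b) i = 1 := by
  rw [mul_comm, W.cap_mul_cup]

theorem Weights.cup_mul_cap' (b : Bool) (i : C) : W.cupW (!b) i * W.capW b i = 1 := by
  simpa using W.cup_mul_cap (!b) i

theorem zigzag_left_op (a : Bool) : shift (cupOp W (!a)) * capOp W a = 1 := by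
  refine op_ext_one fun f i s => ?_
  simp [Module.End.mul_apply, ← mul_assoc, W.cup_mul_cap']

theorem zigzag_right_op (a : Bool) : cupOp W a * shift (capOp W (!a)) = 1 := by
  refine op_ext_one fun f i s => ?_
  simp [Module.End.mul_apply, ← mul_assoc, W.cup_mul_cap]

theorem crossOp_same (v a : Bool) : crossOp W v a a = parOp W v a := by
  simp [crossOp, isPositive]

theorem crossOp_not (v a : Bool) : crossOp W v a (!a) = antiOp W (!v) (!a) := by
  cases v <;> cases a <;> simp [crossOp, isPositive]

theorem crossOp_not' (v a : Bool) : crossOp W v (!a) a = antiOp W (!v) a := by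
  simpa using crossOp_not W v (!a)

/-- One of the two crossings is parallel and the other antiparallel, and each is the rotation of the
other; the weights of minima and maxima cancel. -/
theorem slide_cap_op (v c o : Bool) : shift (crossOp W v c (!o)) * capOp W o =
    crossOp W (!v) o c * shift (capOp W o) := by
  refine op_ext_three fun f i j k s => ?_
  by_cases hc : c = o
  · subst hc
    rw [crossOp_not, crossOp_same]
    have h (l : C) (x : K) : W.cupW (!c) l * (W.capW c l * x) = x := by
      rw [← mul_assoc, W.cup_mul_cap', one_mul]
    simp [Module.End.mul_apply, h, colorRel_swap]
    split_ifs <;> simp_all [mul_assoc, mul_left_comm]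
  · obtain rfl : c = !o := by cases c <;> cases o <;> simp_all
    rw [crossOp_not, crossOp_same]
    have h (l : C) (x : K) : W.cupW (!o) l * (W.capW o l * x) = x := by
      rw [← mul_assoc, W.cup_mul_cap', one_mul]
    simp [Module.End.mul_apply, h, colorRel_swap]
    split_ifs <;> simp_all [mul_assoc, mul_left_comm]

theorem slide_cup_op (v c o : Bool) : shift (cupOp W o) * crossOp W v c o =
    cupOp W o * shift (crossOp W (!v) (!o) c) := by
  refine op_ext_one fun f i s => ?_
  by_cases hc : c = o
  · subst hc
    rw [crossOp_not', crossOp_same]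
    simp only [Module.End.mul_apply, shift_apply, cupOp_apply, parOp_apply, antiOp_apply,
      Bool.not_not, mul_add, Finset.sum_add_distrib]
    congr 1
    · refine Finset.sum_congr rfl fun x _ => ?_
      simp only [eq_comm]
    · simp only [mul_ite, mul_zero, Finset.sum_ite_eq', Finset.mem_univ, if_true, Finset.mul_sum,
        ite_mul, zero_mul]
      refine Finset.sum_congr rfl fun x _ => ?_
      split_ifs
      · linear_combination -W.cupW c x * (W.α v * ((W.Q v - W.Q !v) *
          f (Stream'.cons i (Stream'.cons x (Stream'.cons x s))))) * W.cup_mul_cap c i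
      · rfl
  · obtain rfl : c = !o := by cases c <;> cases o <;> simp_all
    rw [crossOp_not', crossOp_same]
    simp only [Module.End.mul_apply, shift_apply, cupOp_apply, parOp_apply, antiOp_apply,
      Bool.not_not, mul_add, Finset.sum_add_distrib]
    congr 1
    · refine Finset.sum_congr rfl fun x _ => ?_
      simp only [eq_comm]
    · simp only [mul_ite, mul_zero, Finset.sum_ite_eq, Finset.mem_univ, if_true, Finset.mul_sum,
        ite_mul, zero_mul, colorRel_swap]
      refine Finset.sum_congr rfl fun x _ => ?_
      split_ifs
      · linear_combination W.cupW o x * (W.α (!v) * ((W.Q (!v) - W.Q v) *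
          f (Stream'.cons x (Stream'.cons x (Stream'.cons i s))))) * W.cup_mul_cap o i
      · rfl

/-- On equal colours this is the `curl` axiom; on distinct colours both sides vanish. -/
theorem curl_cap_op (v a : Bool) : crossOp W v a (!a) * capOp W (!a) = capOp W a := by
  refine op_ext_two fun f i j s => ?_
  rw [crossOp_not]
  by_cases hij : i = j
  · subst hij
    simp only [Module.End.mul_apply, capOp_apply, antiOp_apply, if_true, Bool.not_not]
    have h1 := W.curl (!v) (!a) i
    have h2 := W.cup_mul_cap' a i
    have h3 : (∑ k, (if ColorRel (!v) (!a) i k then W.cupW (!a) k else 0) *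
        (W.capW (!a) k * f s)) = (∑ k, if ColorRel (!v) (!a) i k then
          W.cupW (!a) k * W.capW (!a) k else 0) * f s := by
      rw [Finset.sum_mul]
      refine Finset.sum_congr rfl fun k _ => ?_
      split_ifs <;> ring
    rw [h3]
    rw [Bool.not_not] at h1
    linear_combination W.capW a i * f s * h1 - W.α (!v) * W.Q (!v) * W.capW (!a) i * f s * h2
  · simp [Module.End.mul_apply, hij, Ne.symm hij]

theorem curl_cup_op (v a : Bool) : cupOp W a * crossOp W v a (!a) = cupOp W (!a) := by
  ext f s
  rw [crossOp_not]
  simp only [Module.End.mul_apply, cupOp_apply, antiOp_apply, if_true, Bool.not_not, mul_add,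
    Finset.sum_add_distrib, Finset.mul_sum]
  rw [Finset.sum_comm (s := Finset.univ) (t := Finset.univ), ← Finset.sum_add_distrib]
  refine Finset.sum_congr rfl fun y _ => ?_
  have h1 := W.curl (!v) a y
  have h2 := W.cup_mul_cap' a y
  have h3 : (∑ x, W.cupW a x * (W.α (!v) * ((W.Q (!v) - W.Q v) * W.capW a x *
      ((if ColorRel (!v) (!a) x y then W.cupW (!a) y else 0) *
        f (Stream'.cons y (Stream'.cons y s)))))) =
      (∑ x, if ColorRel (!v) a y x then W.cupW a x * W.capW a x else 0) *
        (W.α (!v) * (W.Q (!v) - W.Q v) * W.cupW (!a) y *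
          f (Stream'.cons y (Stream'.cons y s))) := by
    rw [Finset.sum_mul]
    refine Finset.sum_congr rfl fun x _ => ?_
    rw [if_congr (colorRel_swap (!v) a x y) rfl rfl]
    split_ifs <;> ring
  rw [h3]
  rw [Bool.not_not] at h1
  linear_combination W.cupW (!a) y * f (Stream'.cons y (Stream'.cons y s)) * h1 -
    W.α (!v) * W.Q (!v) * W.cupW a y * f (Stream'.cons y (Stream'.cons y s)) * h2

theorem par_cancel (e a : Bool) : parOp W e a * parOp W (!e) a = 1 := by
  refine op_ext_two fun f i j s => ?_
  have h1 := W.α_mul e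
  have h2 := W.Q_mul e
  rcases colorRel_trichotomy e a i j with h | rfl | h
  · have h' := h.asymm
    have h3 : i ≠ j := by rintro rfl; exact h' h
    simp [Module.End.mul_apply, colorRel_not_left, h, h', h3, h3.symm]
    linear_combination f (Stream'.cons i (Stream'.cons j s)) * h1
  · simp [Module.End.mul_apply, colorRel_irrefl]
    linear_combination f (Stream'.cons i (Stream'.cons i s)) * (W.Q e * W.Q (!e) * h1 + h2)
  · have h' := h.asymm
    have h3 : i ≠ j := by rintro rfl; exact h' h
    simp [Module.End.mul_apply, colorRel_not_left, h', h3, h3.symm]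
    linear_combination f (Stream'.cons i (Stream'.cons j s)) * h1

/-- The `curl` axioms at `i` and at `k` are subtracted; the colours beyond `k` drop out. -/
theorem Weights.sum_between (e b : Bool) {i k : C} (h : ColorRel e b i k) :
    (W.Q e - W.Q (!e)) * ∑ m, (if ColorRel e b i m ∧ ColorRel e b m k then
      W.cupW b m * W.capW b m else 0) =
      W.Q (!e) * (W.cupW b k * W.capW b k) - W.Q e * (W.cupW b i * W.capW b i) := by
  have h1 := W.curl e b i
  have h2 := W.curl e b k
  have h3 := W.α_mul e
  have h4 : (∑ m, if ColorRel e b i m then W.cupW b m * W.capW b m else 0) =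
      (∑ m, (if ColorRel e b i m ∧ ColorRel e b m k then W.cupW b m * W.capW b m else 0)) +
      W.cupW b k * W.capW b k +
      ∑ m, (if ColorRel e b k m then W.cupW b m * W.capW b m else 0) := by
    have : W.cupW b k * W.capW b k = ∑ m, if m = k then W.cupW b m * W.capW b m else 0 := by
      simp
    rw [this, ← Finset.sum_add_distrib, ← Finset.sum_add_distrib]
    refine Finset.sum_congr rfl fun m _ => ?_
    rcases colorRel_trichotomy e b m k with hm | rfl | hm
    · have h5 := hm.asymm
      have h6 : m ≠ k := by rintro rfl; exact h5 hm
      simp [hm, h5, h6]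
    · simp [h, colorRel_irrefl]
    · have h5 := hm.asymm
      have h6 : m ≠ k := by rintro rfl; exact h5 hm
      simp [hm, h5, h6, h.trans hm]
  rw [h4] at h1
  linear_combination W.α (!e) * (h1 - h2) - ((W.Q e - W.Q (!e)) *
    (∑ m, (if ColorRel e b i m ∧ ColorRel e b m k then W.cupW b m * W.capW b m else 0)) +
    W.Q e * (W.cupW b i * W.capW b i) - W.Q (!e) * (W.cupW b k * W.capW b k)) * h3

theorem anti_cancel (e b : Bool) : antiOp W e b * antiOp W (!e) (!b) = 1 := by
  refine op_ext_two fun f i j s => ?_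
  have h1 := W.α_mul e
  have h2 := W.Q_mul e
  by_cases hij : i = j
  · subst hij
    -- The composite of the two extra terms sums over an intermediate colour `x` between `i` and
    -- `y`; `sum_between` evaluates that sum.
    have key : (∑ x, if ColorRel e b i x then W.cupW b x * (W.α (!e) *
        (W.Q (!e) * f (Stream'.cons x (Stream'.cons x s)) +
          (W.Q (!e) - W.Q e) * W.capW b x * ∑ y, if ColorRel e b x y then
            W.cupW (!b) y * f (Stream'.cons y (Stream'.cons y s)) else 0)) else 0) =
        W.α (!e) * W.Q e * (W.cupW b i * W.capW b i) * ∑ y, if ColorRel e b i y then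
          W.cupW (!b) y * f (Stream'.cons y (Stream'.cons y s)) else 0 := by
      have h3 (x : C) : (if ColorRel e b i x then W.cupW b x * (W.α (!e) *
        (W.Q (!e) * f (Stream'.cons x (Stream'.cons x s)) +
          (W.Q (!e) - W.Q e) * W.capW b x * ∑ y, if ColorRel e b x y then
            W.cupW (!b) y * f (Stream'.cons y (Stream'.cons y s)) else 0)) else 0) =
          (if ColorRel e b i x then W.cupW b x * (W.α (!e) *
            (W.Q (!e) * f (Stream'.cons x (Stream'.cons x s)))) else 0) +
          ∑ y, if ColorRel e b i x ∧ ColorRel e b x y then W.cupW b x * W.capW b x *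
            (W.α (!e) * (W.Q (!e) - W.Q e) *
              (W.cupW (!b) y * f (Stream'.cons y (Stream'.cons y s)))) else 0 := by
        by_cases h : ColorRel e b i x
        · simp only [h, if_true, true_and, Finset.mul_sum, mul_add]
          congr 1
          refine Finset.sum_congr rfl fun y _ => ?_
          split_ifs <;> ring
        · simp [h]
      rw [Finset.sum_congr rfl fun x _ => h3 x, Finset.sum_add_distrib,
        Finset.sum_comm (s := Finset.univ) (t := Finset.univ), ← Finset.sum_add_distrib,
        Finset.mul_sum]
      refine Finset.sum_congr rfl fun y _ => ?_
      have h4 : (∑ x, if ColorRel e b i x ∧ ColorRel e b x y then W.cupW b x * W.capW b x *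
            (W.α (!e) * (W.Q (!e) - W.Q e) *
              (W.cupW (!b) y * f (Stream'.cons y (Stream'.cons y s)))) else 0) =
          (∑ x, if ColorRel e b i x ∧ ColorRel e b x y then W.cupW b x * W.capW b x else 0) *
            (W.α (!e) * (W.Q (!e) - W.Q e) *
              (W.cupW (!b) y * f (Stream'.cons y (Stream'.cons y s)))) := by
        rw [Finset.sum_mul]
        refine Finset.sum_congr rfl fun x _ => ?_
        split_ifs <;> ring
      rw [h4]
      by_cases h : ColorRel e b i y
      · have h5 := W.sum_between e b h
        have h6 := W.cup_mul_cap' b y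
        simp only [h, if_true]
        linear_combination -W.α (!e) * W.cupW (!b) y * f (Stream'.cons y (Stream'.cons y s)) * h5 -
          W.α (!e) * W.Q (!e) * W.cupW b y * f (Stream'.cons y (Stream'.cons y s)) * h6
      · have h7 (x : C) : ¬(ColorRel e b i x ∧ ColorRel e b x y) := fun h' => h (h'.1.trans h'.2)
        simp [h, h7]
    have h8 := W.cap_mul_cup b i
    simp only [Module.End.mul_apply, colorRel_not_left, colorRel_swap, antiOp_apply, if_true,
      Bool.not_not, ite_mul, zero_mul, key, Module.End.one_apply]
    set S := ∑ y, if ColorRel e b i y then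
      W.cupW (!b) y * f (Stream'.cons y (Stream'.cons y s)) else 0
    linear_combination f (Stream'.cons i (Stream'.cons i s)) * (W.Q e * W.Q (!e) * h1 + h2) +
      W.α e * W.α (!e) * W.Q e * (W.Q e - W.Q (!e)) * W.capW b i * S * h8
  · simp [Module.End.mul_apply, hij, Ne.symm hij]
    linear_combination f (Stream'.cons i (Stream'.cons j s)) * h1

theorem cross_cancel_op (v a b : Bool) : crossOp W v a b * crossOp W (!v) b a = 1 := by
  by_cases hab : a = b
  · subst hab
    rw [crossOp_same, crossOp_same, par_cancel]
  · obtain rfl : b = !a := by cases a <;> cases b <;> simp_all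
    rw [crossOp_not, crossOp_not']
    simpa using anti_cancel W (!v) (!a)

end StateSum

section StateSum

variable {C : Type} [LinearOrder C] [Fintype C] {K : Type} [CommRing K] (W : Weights C K)

/-! ### The third Reidemeister move -/

/-- A check over all relative orders of three colours. The relation between the two values of `Q` is
needed only in two cases with a repeated colour. -/
theorem yang_baxter_up : parOp W true true * shift (parOp W true true) * parOp W true true =
    shift (parOp W true true) * parOp W true true * shift (parOp W true true) := by
  refine op_ext_three fun f i j k s => ?_
  have h2 := W.Q_mul true
  rw [Bool.not_true] at h2
  simp only [Module.End.mul_apply, shift_apply, parOp_apply, ColorRel, if_true, Bool.not_true]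
  rcases lt_trichotomy i j with h | h | h <;> rcases lt_trichotomy j k with h' | h' | h' <;>
    rcases lt_trichotomy i k with h'' | h'' | h'' <;> try (exfalso; order)
  all_goals try subst h
  all_goals try subst h'
  all_goals try subst h''
  all_goals simp [*, ne_of_lt, ne_of_gt, not_lt_of_gt]
  all_goals try ring1
  · linear_combination W.α true ^ 3 * (W.Q false - W.Q true) *
      f (Stream'.cons i (Stream'.cons j (Stream'.cons j s))) * h2
  · linear_combination -W.α true ^ 3 * (W.Q false - W.Q true) *
      f (Stream'.cons i (Stream'.cons i (Stream'.cons k s))) * h2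

/-- Invariance under the third Reidemeister move. -/
def YangBaxter (v₁ v₂ v₃ a b c : Bool) : Prop :=
  crossOp W v₁ a b * shift (crossOp W v₃ a c) * crossOp W v₂ b c =
    shift (crossOp W v₂ b c) * crossOp W v₃ a c * shift (crossOp W v₁ a b)

/-- The first strand is bent round to the right of the others by a minimum on the left and a maximum
on the right. Sliding the minimum through the crossings turns those with `a` into crossings with the
bent strand `d`; the zigzag then straightens. -/
theorem rotation_identity {M : Type} [Monoid M] (s : M →* M)
    {cup cap Xab Xac Xbc Xbd Xcd : M} (hz : cup * s cap = 1) (sb : cup * s Xab = s cup * Xbd)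
    (sc : cup * s Xac = s cup * Xcd) (hcup : ∀ T, cup * s (s T) = T * cup)
    (hbc : ∀ T, Xbc * s (s T) = s (s T) * Xbc) (hbd : ∀ T, Xbd * s (s T) = s (s T) * Xbd)
    (hcd : ∀ T, Xcd * s (s T) = s (s T) * Xcd)
    (h : Xab * s Xac * Xbc = s Xbc * Xac * s Xab) :
    Xbc * s Xbd * Xcd = s Xcd * Xbd * s Xbc := by
  have reassoc {a b c d : M} (h : a * b = c * d) (T : M) : a * (b * T) = c * (d * T) := by
    rw [← mul_assoc, h, mul_assoc]
  have shifted {a b c d : M} (h : a * b = c * d) : s a * s b = s c * s d := by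
    rw [← map_mul, h, map_mul]
  have hz' (T : M) : s (s cup) * (s (s (s cap)) * T) = T := by
    rw [← mul_assoc, ← map_mul, ← map_mul, hz, map_one, map_one, one_mul]
  have hh := congrArg (fun T => cup * (s T * s (s (s cap)))) h
  simp only [map_mul, mul_assoc] at hh
  rw [reassoc sb, reassoc (hbd _), reassoc (shifted sc), shifted (hbc _), reassoc (hbd _),
    reassoc (shifted (hcd _)), hz', reassoc (hcup _), reassoc sc, reassoc (hcd _),
    reassoc (shifted sb), hcd, reassoc (shifted (hbd _)), hz'] at hh
  simpa only [mul_assoc] using hh.symm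

variable {W}

/-- By the second Reidemeister move, the crossing of `a` and `b` can be carried to the other side of
the equation as its inverse. -/
theorem YangBaxter.swap_left {v₁ v₂ v₃ a b c : Bool} (h : YangBaxter W (!v₁) v₃ v₂ b a c) :
    YangBaxter W v₁ v₂ v₃ a b c := by
  have h1 := cross_cancel_op W v₁ a b
  have h2 := congrArg shift (cross_cancel_op W (!v₁) b a)
  rw [map_mul, map_one, Bool.not_not] at h2
  unfold YangBaxter at h ⊢
  calc _ = crossOp W v₁ a b * (shift (crossOp W v₃ a c) * crossOp W v₂ b c *
        shift (crossOp W (!v₁) b a)) * shift (crossOp W v₁ a b) := by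
        simp only [mul_assoc, h2, mul_one]
    _ = (crossOp W v₁ a b * crossOp W (!v₁) b a) * shift (crossOp W v₂ b c) *
        crossOp W v₃ a c * shift (crossOp W v₁ a b) := by rw [← h]; simp only [mul_assoc]
    _ = _ := by rw [h1, one_mul]

theorem YangBaxter.swap_right {v₁ v₂ v₃ a b c : Bool} (h : YangBaxter W v₃ (!v₂) v₁ a c b) :
    YangBaxter W v₁ v₂ v₃ a b c := by
  have h1 := congrArg shift (cross_cancel_op W v₂ b c)
  have h2 := cross_cancel_op W (!v₂) c b
  rw [map_mul, map_one] at h1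
  rw [Bool.not_not] at h2
  unfold YangBaxter at h ⊢
  calc _ = (shift (crossOp W v₂ b c) * shift (crossOp W (!v₂) c b)) * crossOp W v₁ a b *
        shift (crossOp W v₃ a c) * crossOp W v₂ b c := by rw [h1, one_mul]
    _ = shift (crossOp W v₂ b c) * (shift (crossOp W (!v₂) c b) * crossOp W v₁ a b *
        shift (crossOp W v₃ a c)) * crossOp W v₂ b c := by simp only [mul_assoc]
    _ = shift (crossOp W v₂ b c) * crossOp W v₃ a c * shift (crossOp W v₁ a b) *
        (crossOp W (!v₂) c b * crossOp W v₂ b c) := by rw [← h]; simp only [mul_assoc]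
    _ = _ := by rw [h2, mul_one]

theorem YangBaxter.rotate {v₁ v₂ v₃ a b c : Bool} (h : YangBaxter W v₁ v₂ v₃ a b c) :
    YangBaxter W v₂ (!v₃) (!v₁) b c (!a) := by
  have ha (v x : Bool) : cupOp W (!a) * shift (crossOp W v a x) =
      shift (cupOp W (!a)) * crossOp W (!v) x (!a) := by
    rw [slide_cup_op, Bool.not_not, Bool.not_not]
  exact rotation_identity shift (by simpa using zigzag_right_op W (!a)) (ha _ _) (ha _ _)
    (cupOp_mul_shift W _) (crossOp_mul_shift W _ _ _) (crossOp_mul_shift W _ _ _)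
    (crossOp_mul_shift W _ _ _) h

variable (W)

theorem yangBaxter_up (v₁ v₂ v₃ : Bool) (h : v₁ = v₂ → v₃ = v₁) :
    YangBaxter W v₁ v₂ v₃ true true true := by
  have h0 : YangBaxter W true true true true true true := by
    unfold YangBaxter; simpa only [crossOp_same] using yang_baxter_up W
  have h1 : YangBaxter W true false true true true true := .swap_right h0
  have h2 : YangBaxter W false true true true true true := .swap_left h0
  have h3 : YangBaxter W true false false true true true := .swap_right h2
  have h4 : YangBaxter W false true false true true true := .swap_left h1
  have h5 : YangBaxter W false false false true true true := .swap_left h3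
  cases v₁ <;> cases v₂ <;> cases v₃ <;> first | assumption | simp at h

/-- Rotation reverses one strand and the swaps permute neighbours, so all directions are reached
from three upward strands. All these operations preserve the acyclicity of the levels. -/
theorem yangBaxter (v₁ v₂ v₃ a b c : Bool) (h : v₁ = v₂ → v₃ = v₁) :
    YangBaxter W v₁ v₂ v₃ a b c := by
  have rot {a b c : Bool}
      (H : ∀ v₁ v₂ v₃ : Bool, (v₁ = v₂ → v₃ = v₁) → YangBaxter W v₁ v₂ v₃ a b c) :
      ∀ v₁ v₂ v₃ : Bool, (v₁ = v₂ → v₃ = v₁) → YangBaxter W v₁ v₂ v₃ b c (!a) := by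
    intro v₁ v₂ v₃ h
    simpa using (H (!v₃) v₁ (!v₂) (by cases v₁ <;> cases v₂ <;> cases v₃ <;> simp at h ⊢)).rotate
  have left {a b c : Bool}
      (H : ∀ v₁ v₂ v₃ : Bool, (v₁ = v₂ → v₃ = v₁) → YangBaxter W v₁ v₂ v₃ a b c) :
      ∀ v₁ v₂ v₃ : Bool, (v₁ = v₂ → v₃ = v₁) → YangBaxter W v₁ v₂ v₃ b a c := by
    intro v₁ v₂ v₃ h
    exact (H (!v₁) v₃ v₂ (by cases v₁ <;> cases v₂ <;> cases v₃ <;> simp at h ⊢)).swap_left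
  have right {a b c : Bool}
      (H : ∀ v₁ v₂ v₃ : Bool, (v₁ = v₂ → v₃ = v₁) → YangBaxter W v₁ v₂ v₃ a b c) :
      ∀ v₁ v₂ v₃ : Bool, (v₁ = v₂ → v₃ = v₁) → YangBaxter W v₁ v₂ v₃ a c b := by
    intro v₁ v₂ v₃ h
    exact (H v₃ (!v₂) v₁ (by cases v₁ <;> cases v₂ <;> cases v₃ <;> simp at h ⊢)).swap_right
  -- The index counts the strands that are directed upwards.
  have h3 := yangBaxter_up W
  have h2 := rot h3
  have h1 := rot h2
  have h0 := rot h1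
  revert v₁ v₂ v₃
  cases a <;> cases b <;> cases c
  · exact h0
  · exact right (left h1)
  · exact left h1
  · exact left (right h2)
  · exact h1
  · exact right h2
  · exact h2
  · exact h3

/-! ### Invariance of the state sum -/

/-- The operator of a word. -/
def wordOp (w : List Layer) : Module.End K (StateFun C K) :=
  (w.map fun e => shift^[e.left.length] (pieceOp W e.piece)).prod

@[simp] theorem wordOp_nil : wordOp W [] = 1 := rfl

@[simp] theorem wordOp_cons (e : Layer) (w : List Layer) :
    wordOp W (e :: w) = shift^[e.left.length] (pieceOp W e.piece) * wordOp W w := by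
  simp [wordOp]

@[simp] theorem wordOp_append (u w : List Layer) :
    wordOp W (u ++ w) = wordOp W u * wordOp W w := by
  simp [wordOp]

theorem wordOp_pad (a b : List Bool) (w : List Layer) :
    wordOp W (pad a b w) = shift^[a.length] (wordOp W w) := by
  induction w with
  | nil => simp [iterate_map_one]
  | cons e w ih =>
    simp only [pad_cons, wordOp_cons, ih, iterate_map_mul, List.length_append,
      Function.iterate_add_apply]

theorem Move.wordOp_eq {p q : List Layer} (h : Move p q) : wordOp W p = wordOp W q := by
  cases h with
  | exchange p y q =>
    simpa [Function.iterate_add_apply] using pieceOp_mul_shift W p _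
  | zigzagLeft a => simpa [pieceOp] using zigzag_left_op W a
  | zigzagRight a => simpa [pieceOp] using zigzag_right_op W a
  | slideCap v c o => simpa [pieceOp] using slide_cap_op W v c o
  | slideCup v c o => simpa [pieceOp] using slide_cup_op W v c o
  | reidemeisterOneCap v a => simpa [pieceOp] using curl_cap_op W v a
  | reidemeisterOneCup v a => simpa [pieceOp] using curl_cup_op W v a
  | reidemeisterTwo v a b => simpa [pieceOp] using cross_cancel_op W v a b
  | reidemeisterThree v₁ v₂ v₃ a b c h =>
    simpa [pieceOp, mul_assoc, YangBaxter] using yangBaxter W v₁ v₂ v₃ a b c h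

/-- The operator of a smoothed crossing. -/
def smoothOp (a b : Bool) : Module.End K (StateFun C K) :=
  if a = b then 1 else capOp W a * cupOp W b

/-- The exchange terms cancel except on equal colours. What is left there, together with the extra
terms for the two opposite orders of colours, makes up the whole smoothing. -/
theorem crossOp_skein (vp vm a b : Bool) (hp : isPositive vp a b = true)
    (hm : isPositive vm a b = false) :
    W.α false • crossOp W vp a b - W.α true • crossOp W vm a b =
      (W.Q true - W.Q false) • smoothOp W a b := by
  refine op_ext_two fun f i j s => ?_
  have h1 := W.α_mul true
  rw [Bool.not_true] at h1
  simp only [crossOp, smoothOp, hp, hm]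
  by_cases hab : a = b
  · simp only [hab, if_true]
    rcases colorRel_trichotomy true b i j with h | rfl | h
    · have h' := h.asymm
      have h3 : i ≠ j := by rintro rfl; exact h' h
      have h4 : ¬ ColorRel false b i j := by rwa [← Bool.not_true, colorRel_not_left]
      simp [h, h3, h4]
      linear_combination ((W.Q true - W.Q false) * f (Stream'.cons i (Stream'.cons j s))) * h1
    · simp [colorRel_irrefl]
      linear_combination ((W.Q true - W.Q false) * f (Stream'.cons i (Stream'.cons i s))) * h1
    · have h' := h.asymm
      have h3 : i ≠ j := by rintro rfl; exact h' h
      have h4 : ColorRel false b i j := by rwa [← Bool.not_true, colorRel_not_left]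
      simp [h', h3, h4]
      linear_combination ((W.Q true - W.Q false) * f (Stream'.cons i (Stream'.cons j s))) * h1
  · obtain rfl : a = !b := by cases a <;> cases b <;> simp_all
    by_cases hij : i = j
    · subst hij
      have h2 : (∑ k, W.cupW b k * f (Stream'.cons k (Stream'.cons k s))) =
          (∑ k, if ColorRel true b i k then W.cupW b k * f (Stream'.cons k (Stream'.cons k s))
            else 0) + W.cupW b i * f (Stream'.cons i (Stream'.cons i s)) +
          ∑ k, if ColorRel false b i k then W.cupW b k * f (Stream'.cons k (Stream'.cons k s))
            else 0 := by
        have : W.cupW b i * f (Stream'.cons i (Stream'.cons i s)) =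
            ∑ k, if i = k then W.cupW b k * f (Stream'.cons k (Stream'.cons k s)) else 0 := by
          simp
        rw [this, ← Finset.sum_add_distrib, ← Finset.sum_add_distrib]
        refine Finset.sum_congr rfl fun k _ => ?_
        rw [← Bool.not_true, if_congr (colorRel_not_left true b i k) rfl rfl]
        rcases colorRel_trichotomy true b i k with h | rfl | h
        · have h' := h.asymm
          have h3 : i ≠ k := by rintro rfl; exact h' h
          simp [h, h', h3]
        · simp [colorRel_irrefl]
        · have h' := h.asymm
          have h3 : i ≠ k := by rintro rfl; exact h' h
          simp [h, h', h3]
      have h4 := W.cap_mul_cup b i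
      simp [Module.End.mul_apply, h2]
      set S := ∑ k, if ColorRel true b i k then
        W.cupW b k * f (Stream'.cons k (Stream'.cons k s)) else 0
      set S' := ∑ k, if ColorRel false b i k then
        W.cupW b k * f (Stream'.cons k (Stream'.cons k s)) else 0
      set F := f (Stream'.cons i (Stream'.cons i s))
      linear_combination ((W.Q true - W.Q false) * F + (W.Q true - W.Q false) *
        W.capW (!b) i * (S + S')) * h1 - (W.Q true - W.Q false) * F * h4
    · simp [hij, Module.End.mul_apply]
      ring

/-- The state sum of a word. -/
def stateSum (s : Stream' C) (w : List Layer) : K := wordOp W w 1 s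

theorem wordOp_smoothing (a b : Bool) (l r : List Bool) :
    wordOp W (smoothing a b l r) = shift^[l.length] (smoothOp W a b) := by
  unfold smoothing smoothOp
  split_ifs
  · simp [iterate_map_one]
  · simp [iterate_map_mul, pieceOp]

omit [LinearOrder C] [Fintype C] in
theorem shift_smul (c : K) (T : Module.End K (StateFun C K)) : shift (c • T) = c • shift T := rfl

omit [LinearOrder C] [Fintype C] in
theorem shift_sub (S T : Module.End K (StateFun C K)) : shift (S - T) = shift S - shift T := rfl

omit [LinearOrder C] [Fintype C] in
theorem shift_iterate_skein {S T U : Module.End K (StateFun C K)} {a b c : K}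
    (h : a • S - b • T = c • U) (n : ℕ) :
    a • shift^[n] S - b • shift^[n] T = c • shift^[n] U := by
  induction n with
  | zero => exact h
  | succ n ih =>
    simp only [Function.iterate_succ_apply', ← shift_smul, ← shift_sub, ih]

theorem stateSum_skein (s : Stream' C) (u t : List Layer) (l r : List Bool) (vp vm a b : Bool)
    (hp : isPositive vp a b = true) (hm : isPositive vm a b = false) :
    W.α false * stateSum W s (u ++ [⟨l, .cross vp a b, r⟩] ++ t) -
      W.α true * stateSum W s (u ++ [⟨l, .cross vm a b, r⟩] ++ t) =
      (W.Q true - W.Q false) * stateSum W s (u ++ smoothing a b l r ++ t) := by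
  have h := shift_iterate_skein (crossOp_skein W vp vm a b hp hm) l.length
  have h2 := congrArg (fun T => (wordOp W u * T * wordOp W t) 1 s) h
  simp only [mul_sub, sub_mul, mul_smul_comm, smul_mul_assoc] at h2
  simpa [stateSum, wordOp_smoothing, pieceOp] using h2

theorem stateSum_step (s : Stream' C) {x y : List Bool} {w w' : List Layer}
    (h : TangleStep x y w w') : stateSum W s w = stateSum W s w' := by
  obtain ⟨-, -, u, t, p, q, a, b, hm, rfl, rfl⟩ := h
  simp [stateSum, wordOp_pad, hm.wordOp_eq W]

theorem stateSum_unknot (s : Stream' C) :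
    stateSum W s unknot.word = ∑ i, W.cupW true i * W.capW true i := by
  simp [stateSum, unknot, pieceOp, Module.End.mul_apply]

end StateSum

/-! ### Weights with colours in `Fin N` -/

theorem fin_sum_lt_telescope {N : ℕ} (G : ℕ → ℂ) (i : Fin N) :
    ∑ k : Fin N, (if k < i then G (k + 1) - G k else 0) = G i - G 0 := by
  have h := Fin.sum_univ_eq_sum_range (fun k => if k < (i : ℕ) then G (k + 1) - G k else 0) N
  simp only [Fin.val_fin_lt] at h
  rw [h, ← Finset.sum_filter, ← Finset.sum_range_sub G i]
  congr 1
  ext k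
  have := i.2
  simp only [Finset.mem_filter, Finset.mem_range]
  omega

theorem fin_sum_gt_telescope {N : ℕ} (G : ℕ → ℂ) (i : Fin N) :
    ∑ k : Fin N, (if i < k then G (k + 1) - G k else 0) = G N - G (i + 1) := by
  have h1 := fin_sum_lt_telescope G i
  have h2 : ∑ k : Fin N, (G (k + 1) - G k) = G N - G 0 := by
    rw [Fin.sum_univ_eq_sum_range (fun k => G (k + 1) - G k) N, Finset.sum_range_sub]
  have h3 : ∑ k : Fin N, (G (k + 1) - G k) =
      ∑ k : Fin N, (if k < i then G (k + 1) - G k else 0) + (G (i + 1) - G i) +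
      ∑ k : Fin N, (if i < k then G (k + 1) - G k else 0) := by
    have : G (i + 1) - G i = ∑ k : Fin N, if k = i then G (k + 1) - G k else 0 := by simp
    rw [this, ← Finset.sum_add_distrib, ← Finset.sum_add_distrib]
    refine Finset.sum_congr rfl fun k _ => ?_
    rcases lt_trichotomy k i with h | rfl | h
    · simp [h, h.ne, h.not_gt]
    · simp
    · simp [h, h.ne', h.not_gt]
  linear_combination h2 - h1 - h3

theorem zpow_mul_telescope {q : ℂ} (hq : q ≠ 0) {n a b c : ℤ} (h : a = c) (h' : n + b = 0) :
    q ^ n * (q ^ a + (q ^ b - q ^ c)) = 1 := by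
  rw [h, add_sub_cancel, ← zpow_add₀ hq, h', zpow_zero]

/-- The weights that belong to the `N`-dimensional representation. -/
noncomputable def finWeights (N : ℕ) (q : ℂ) (hq : q ≠ 0) : Weights (Fin N) ℂ where
  Q e := if e then q else q⁻¹
  α e := if e then q ^ (-N : ℤ) else q ^ (N : ℤ)
  -- A circle of colour `i` gets the weight `q ^ (2 * i + 1 - N)` or its inverse, as in the quantum
  -- trace.
  cupW o i := if o then 1 else q ^ (N - 2 * i - 1 : ℤ)
  capW o i := if o then q ^ (2 * i + 1 - N : ℤ) else 1
  Q_mul e := by cases e <;> simp [hq]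
  α_mul e := by cases e <;> simp [hq]
  cap_mul_cup b i := by
    cases b
    · simp only [Bool.not_false, if_true, Bool.false_eq_true, if_false]
      rw [← zpow_add₀ hq, show (2 * i + 1 - N + (N - 2 * i - 1) : ℤ) = 0 by ring, zpow_zero]
    · simp
  curl e b i := by
    -- The factor `q - q⁻¹` turns each circle weight into a difference of powers, so the sum over
    -- colours telescopes; its inner end cancels the term of colour `i`, and its outer end cancels
    -- `α`.
    have hz (n : ℤ) : (q - q⁻¹) * q ^ n = q ^ (n + 1) - q ^ (n - 1) := by
      rw [zpow_add_one₀ hq, zpow_sub_one₀ hq]; ring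
    have hz' (n : ℤ) : (q⁻¹ - q) * q ^ n = q ^ (n - 1) - q ^ (n + 1) := by
      rw [zpow_add_one₀ hq, zpow_sub_one₀ hq]; ring
    have e1 (n : ℤ) : q * q ^ n = q ^ (n + 1) := by rw [zpow_add_one₀ hq]; ring
    have e2 (n : ℤ) : q⁻¹ * q ^ n = q ^ (n - 1) := by rw [zpow_sub_one₀ hq]; ring
    cases e <;> cases b <;>
    simp only [ColorRel, Bool.not_true, Bool.not_false, Bool.false_eq_true, Bool.true_eq_false,
      if_true, if_false, mul_one, one_mul, Finset.mul_sum, mul_ite, mul_zero, hz, hz', e1, e2]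
    · have h := fin_sum_gt_telescope (fun k => q ^ (N - 2 * k : ℤ)) i
      refine (congrArg (fun t => q ^ (N : ℤ) * (_ + t))
        ((Finset.sum_congr rfl fun x _ => ?_).trans h)).trans ?_
      · congr 3 <;> push_cast <;> ring
      · exact zpow_mul_telescope hq (by push_cast; ring) (by ring)
    · have h := fin_sum_lt_telescope (fun k => - q ^ (2 * k - N : ℤ)) i
      simp only [neg_sub_neg] at h
      refine (congrArg (fun t => q ^ (N : ℤ) * (_ + t))
        ((Finset.sum_congr rfl fun x _ => ?_).trans h)).trans ?_
      · congr 3 <;> push_cast <;> ring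
      · exact zpow_mul_telescope hq (by ring) (by push_cast; ring)
    · have h := fin_sum_lt_telescope (fun k => - q ^ (N - 2 * k : ℤ)) i
      simp only [neg_sub_neg] at h
      refine (congrArg (fun t => q ^ (-N : ℤ) * (_ + t))
        ((Finset.sum_congr rfl fun x _ => ?_).trans h)).trans ?_
      · congr 3 <;> push_cast <;> ring
      · exact zpow_mul_telescope hq (by ring) (by push_cast; ring)
    · have h := fin_sum_gt_telescope (fun k => q ^ (2 * k - N : ℤ)) i
      refine (congrArg (fun t => q ^ (-N : ℤ) * (_ + t))
        ((Finset.sum_congr rfl fun x _ => ?_).trans h)).trans ?_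
      · congr 3 <;> push_cast <;> ring
      · exact zpow_mul_telescope hq (by push_cast; ring) (by ring)

/-! ### Separation of Laurent polynomials -/

theorem laurent_eq_zero {R : Type} [CommRing R] [IsDomain R] (p : R[T;T⁻¹]) {S : Set Rˣ}
    (hS : S.Infinite) (h : ∀ u ∈ S, LaurentPolynomial.eval₂ (RingHom.id R) u p = 0) : p = 0 := by
  obtain ⟨n, p', hp⟩ := p.exists_T_pow
  have hp' : p' = 0 := by
    refine Polynomial.eq_zero_of_infinite_isRoot p' ((hS.image Units.val_injective.injOn).mono ?_)
    rintro _ ⟨u, hu, rfl⟩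
    have h1 := congrArg (LaurentPolynomial.eval₂ (RingHom.id R) u) hp
    rw [map_mul, h u hu, zero_mul, LaurentPolynomial.eval₂_toLaurent] at h1
    exact h1
  rw [hp', map_zero] at hp
  have h2 : p * LaurentPolynomial.T n * LaurentPolynomial.T (-n) = 0 := by rw [← hp, zero_mul]
  rwa [mul_assoc, ← LaurentPolynomial.T_add, add_neg_cancel, LaurentPolynomial.T_zero, mul_one]
    at h2

theorem laurent_hom_ext {R S : Type} [CommRing R] [CommRing S] {f g : R[T;T⁻¹] →+* S}
    (hC : ∀ a, f (LaurentPolynomial.C a) = g (LaurentPolynomial.C a))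
    (hT : f (LaurentPolynomial.T 1) = g (LaurentPolynomial.T 1)) : f = g := by
  have h1 (φ : R[T;T⁻¹] →+* S) : φ (LaurentPolynomial.T 1) * φ (LaurentPolynomial.T (-1)) = 1 := by
    rw [← map_mul, ← LaurentPolynomial.T_add]; simp
  have hT' : f (LaurentPolynomial.T (-1)) = g (LaurentPolynomial.T (-1)) := by
    have h2 := h1 f
    have h3 := h1 g
    rw [← hT] at h3
    linear_combination g (LaurentPolynomial.T (-1)) * h2 - f (LaurentPolynomial.T (-1)) * h3
  refine RingHom.ext fun p => ?_
  induction p using LaurentPolynomial.induction_on with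
  | h_C a => exact hC a
  | h_add hp hq => rw [map_add, map_add, hp, hq]
  | h_C_mul_T n a h =>
    rw [LaurentPolynomial.T_add, ← mul_assoc, map_mul, h, hT, ← map_mul]
  | h_C_mul_T_Z n a h =>
    rw [sub_eq_add_neg, LaurentPolynomial.T_add, ← mul_assoc, map_mul, h, hT', ← map_mul]

/-- The evaluation at two units. -/
noncomputable def evalAt (x y : ℂˣ) : LaurentLM →+* ℂ :=
  LaurentPolynomial.eval₂ (LaurentPolynomial.eval₂ (RingHom.id ℂ) x) y

theorem evalAt_eq (x y : ℂˣ) (p : LaurentLM) :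
    evalAt x y p = LaurentPolynomial.eval₂ (RingHom.id ℂ) x
      (LaurentPolynomial.eval₂ (RingHom.id ℂ[T;T⁻¹])
        (Units.map (LaurentPolynomial.C : ℂ →+* ℂ[T;T⁻¹]).toMonoidHom y) p) := by
  refine congrFun (congrArg DFunLike.coe (laurent_hom_ext (f := evalAt x y)
    (g := (LaurentPolynomial.eval₂ (RingHom.id ℂ) x).comp
      (LaurentPolynomial.eval₂ (RingHom.id ℂ[T;T⁻¹])
        (Units.map (LaurentPolynomial.C : ℂ →+* ℂ[T;T⁻¹]).toMonoidHom y))) (fun a => ?_) ?_)) p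
  · rw [evalAt, LaurentPolynomial.eval₂_C]
    exact (congrArg _ (LaurentPolynomial.eval₂_C (RingHom.id _) _ a)).symm
  · simp only [evalAt, RingHom.comp_apply, LaurentPolynomial.eval₂_T, zpow_one, Units.coe_map]
    exact (LaurentPolynomial.eval₂_C (RingHom.id ℂ) x (y : ℂ)).symm

theorem qDiff_ne_zero {q : ℝ} (hq : 1 < q) : (q : ℂ) - (q : ℂ)⁻¹ ≠ 0 := by
  rw [← Complex.ofReal_inv, ← Complex.ofReal_sub, Complex.ofReal_ne_zero]
  have := inv_lt_one_of_one_lt₀ hq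
  linarith

theorem q_ne_zero {q : ℝ} (hq : 1 < q) : (q : ℂ) ≠ 0 :=
  Complex.ofReal_ne_zero.2 (by linarith)

/-- The value of `l` for the state sum with `N` colours. -/
noncomputable def unitL (N : ℕ) {q : ℝ} (hq : 1 < q) : ℂˣ :=
  Units.mk0 (Complex.I * (q : ℂ) ^ (N : ℤ))
    (mul_ne_zero Complex.I_ne_zero (zpow_ne_zero _ (q_ne_zero hq)))

/-- The value of `m` for the state sums. -/
noncomputable def unitM {q : ℝ} (hq : 1 < q) : ℂˣ :=
  Units.mk0 (-Complex.I * ((q : ℂ) - (q : ℂ)⁻¹))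
    (mul_ne_zero (neg_ne_zero.2 Complex.I_ne_zero) (qDiff_ne_zero hq))

/-- For fixed `q`, the values of `l` for varying `N` are infinitely many, so the polynomial in `l`
obtained by fixing `m` vanishes. The values of `m` for varying `q` are also infinitely many. -/
theorem laurentLM_eq_zero (p : LaurentLM)
    (h : ∀ (N : ℕ) (q : ℝ) (hq : 1 < q), 0 < N → evalAt (unitL N hq) (unitM hq) p = 0) :
    p = 0 := by
  refine laurent_eq_zero p (S := Set.range fun q : Set.Ioi (1 : ℝ) =>
    Units.map (LaurentPolynomial.C : ℂ →+* ℂ[T;T⁻¹]).toMonoidHom (unitM q.2)) ?_ ?_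
  · have : Infinite (Set.Ioi (1 : ℝ)) := (Set.Ioi_infinite 1).to_subtype
    refine Set.infinite_range_of_injective fun q r hqr => ?_
    have h1 := congrArg Units.val hqr
    have h2 : ((unitM q.2 : ℂˣ) : ℂ) = unitM r.2 := by
      have := congrArg (LaurentPolynomial.eval₂ (RingHom.id ℂ) 1) h1
      simpa using this
    have h3 : (q : ℝ) - (q : ℝ)⁻¹ = (r : ℝ) - (r : ℝ)⁻¹ := by
      have h4 : (q : ℂ) - (q : ℂ)⁻¹ = (r : ℂ) - (r : ℂ)⁻¹ := by
        simpa [unitM, Complex.I_ne_zero] using h2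
      exact_mod_cast h4
    have hq : 1 < (q : ℝ) := q.2
    have hr : 1 < (r : ℝ) := r.2
    have h5 : ((q : ℝ) - r) * (q * r + 1) = 0 := by
      field_simp at h3
      linear_combination h3
    rcases mul_eq_zero.1 h5 with h6 | h6
    · exact Subtype.ext (by linarith)
    · nlinarith
  · rintro _ ⟨⟨q, hq⟩, rfl⟩
    refine laurent_eq_zero _ (S := Set.range fun N : ℕ => unitL (N + 1) hq) ?_ ?_
    · refine Set.infinite_range_of_injective fun M N hMN => ?_
      have h1 := congrArg Units.val hMN
      have h2 : (q : ℂ) ^ (M + 1) = (q : ℂ) ^ (N + 1) := by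
        have h3 := mul_left_cancel₀ Complex.I_ne_zero h1
        simpa only [zpow_natCast] using h3
      have h4 : q ^ (M + 1) = q ^ (N + 1) := by exact_mod_cast h2
      have := pow_right_injective₀ (by linarith [show (1:ℝ) < q from hq]) (ne_of_gt hq) h4
      omega
    · rintro _ ⟨N, rfl⟩
      rw [← evalAt_eq]
      exact h (N + 1) q hq N.succ_pos

/-! ### Existence -/

/-- Multiplying the relation of the state sum by `i` changes its sign pattern into the required one,
because the inverse of `i` is `-i`. -/
theorem stateSum_isSkein (N : ℕ) {q : ℝ} (hq : 1 < q) (s : Stream' (Fin N)) :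
    IsSkein (evalAt (unitL N hq) (unitM hq)) []
      (stateSum (finWeights N q (q_ne_zero hq)) s) := by
  refine ⟨fun w w' h => stateSum_step _ _ h, fun u t l r vp vm a b hp hm _ => ?_⟩
  have h := stateSum_skein (finWeights N q (q_ne_zero hq)) s u t l r vp vm a b hp hm
  have e1 : evalAt (unitL N hq) (unitM hq) varL = Complex.I * (q : ℂ) ^ (N : ℤ) := by
    simp only [evalAt, LaurentPolynomial.eval₂_C, LaurentPolynomial.eval₂_T, zpow_one, unitL,
      Units.val_mk0]
  have e2 : evalAt (unitL N hq) (unitM hq) varLInv = -Complex.I * (q : ℂ) ^ (-N : ℤ) := by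
    simp only [evalAt, LaurentPolynomial.eval₂_C, LaurentPolynomial.eval₂_T, zpow_neg, zpow_one,
      unitL, Units.val_inv_eq_inv_val, Units.val_mk0, mul_inv, Complex.inv_I]
  have e3 : evalAt (unitL N hq) (unitM hq) varM = -Complex.I * ((q : ℂ) - (q : ℂ)⁻¹) := by
    simp only [evalAt, LaurentPolynomial.eval₂_T, zpow_one, unitM, Units.val_mk0]
  rw [e1, e2, e3]
  rw [show (finWeights N q (q_ne_zero hq)).α false = (q : ℂ) ^ (N : ℤ) from rfl,
    show (finWeights N q (q_ne_zero hq)).α true = (q : ℂ) ^ (-N : ℤ) from rfl,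
    show (finWeights N q (q_ne_zero hq)).Q false = (q : ℂ)⁻¹ from rfl,
    show (finWeights N q (q_ne_zero hq)).Q true = (q : ℂ) from rfl] at h
  linear_combination Complex.I * h

theorem stateSum_unknot_ne_zero {N : ℕ} (hN : 0 < N) {q : ℝ} (hq : 1 < q) (s : Stream' (Fin N)) :
    stateSum (finWeights N q (q_ne_zero hq)) s unknot.word ≠ 0 := by
  rw [stateSum_unknot]
  have : Nonempty (Fin N) := ⟨⟨0, hN⟩⟩
  have h : 0 < ∑ i : Fin N, q ^ (2 * (i : ℤ) + 1 - N) :=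
    Finset.sum_pos (fun i _ => zpow_pos (by linarith) _) Finset.univ_nonempty
  have h2 : (∑ i : Fin N, q ^ (2 * (i : ℤ) + 1 - N) : ℝ) ≠ 0 := h.ne'
  have h3 := Complex.ofReal_ne_zero.2 h2
  push_cast at h3
  simpa [finWeights] using h3

/-- Applied to the state sums, the hypothesis gives the relation times the nonzero value of the
unknot, at points that separate Laurent polynomials. -/
theorem eval_relation {L₁ L₂ L₃ : LinkDiagram} {a b c : LaurentLM}
    (h : ∀ (K : Type) [Field K] (φ : LaurentLM →+* K) (f : List Layer → K), IsSkein φ [] f →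
      φ a * f L₁.word + φ b * f L₂.word + φ c * f L₃.word = 0) :
    a * L₁.eval + b * L₂.eval + c * L₃.eval = 0 := by
  refine laurentLM_eq_zero _ fun N q hq hN => ?_
  have hf := stateSum_isSkein N hq (Stream'.const ⟨0, hN⟩)
  have h1 := h ℂ _ _ hf
  rw [L₁.eval_spec hf, L₂.eval_spec hf, L₃.eval_spec hf] at h1
  refine (mul_eq_zero.1 ?_).resolve_right
    (stateSum_unknot_ne_zero hN hq (Stream'.const ⟨0, hN⟩))
  rw [map_add, map_add, map_mul, map_mul, map_mul]
  linear_combination h1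

theorem eval_eq {L L' : LinkDiagram}
    (h : ∀ (K : Type) [Field K] (φ : LaurentLM →+* K) (f : List Layer → K), IsSkein φ [] f →
      f L.word = f L'.word) : L.eval = L'.eval := by
  refine sub_eq_zero.1 (laurentLM_eq_zero _ fun N q hq hN => ?_)
  have hf := stateSum_isSkein N hq (Stream'.const ⟨0, hN⟩)
  have h1 := h ℂ _ _ hf
  rw [L.eval_spec hf, L'.eval_spec hf] at h1
  rw [map_sub, sub_eq_zero]
  exact mul_right_cancel₀ (stateSum_unknot_ne_zero hN hq (Stream'.const ⟨0, hN⟩)) h1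

theorem isHomfly_eval : IsHomfly LinkDiagram.eval where
  invariant L L' h := by
    induction h with
    | rel L L' h =>
      obtain ⟨u, w, p, q, x, y, hm, h1, h2⟩ := h
      exact eval_eq fun K _ φ f hf =>
        hf.step _ _ ⟨L.goes, L'.goes, u, w, p, q, x, y, hm, h1, h2⟩
    | refl => rfl
    | symm _ _ _ ih => exact ih.symm
    | trans _ _ _ _ _ ih ih' => exact ih.trans ih'
  normalization := by
    have h : (1 : LaurentLM) - unknot.eval = 0 := by
      refine laurentLM_eq_zero _ fun N q hq hN => ?_
      have hf := stateSum_isSkein N hq (Stream'.const ⟨0, hN⟩)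
      have h1 := unknot.eval_spec hf
      have h2 := stateSum_unknot_ne_zero hN hq (Stream'.const ⟨0, hN⟩)
      have h3 : evalAt (unitL N hq) (unitM hq) unknot.eval = 1 :=
        mul_right_cancel₀ h2 (by rw [one_mul, ← h1])
      rw [map_sub, map_one, h3, sub_self]
    exact (sub_eq_zero.1 h).symm
  skein Lp Lm Lz h := by
    obtain ⟨u, w, x, y, vp, vm, a, b, hp, hm, h1, h2, h3⟩ := h
    refine eval_relation fun K _ φ f hf => ?_
    rw [h1, h2, h3]
    exact hf.skein u w x y vp vm a b hp hm (by rw [← h1]; exact Lp.goes)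

theorem isHomfly_homfly : IsHomfly homfly := Classical.epsilon_spec ⟨_, isHomfly_eval⟩

theorem IsHomfly.eq_homfly {P : LinkDiagram → LaurentLM} (hP : IsHomfly P) : P = homfly :=
  funext fun L => by rw [hP.eq_eval, isHomfly_homfly.eq_eval]

/-! ### Mirror images and reversal -/

theorem isotopic_map {F : LinkDiagram → LinkDiagram} (g : Layer → Layer)
    (r : List Bool → List Bool) (hF : ∀ L, (F L).word = L.word.map g)
    (hpad : ∀ x y w, (pad x y w).map g = pad (r x) (r y) (w.map g))
    (hmove : ∀ p q, Move p q → Move (p.map g) (q.map g)) {L L' : LinkDiagram}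
    (h : Isotopic L L') : Isotopic (F L) (F L') := by
  refine eqvGen_map F ?_ h
  rintro L L' ⟨u, w, p, q, x, y, hm, h1, h2⟩
  exact ⟨u.map g, w.map g, p.map g, q.map g, r x, r y, hmove _ _ hm,
    by rw [hF, h1]; simp [hpad], by rw [hF, h2]; simp [hpad]⟩

theorem Move.mirror {p q : List Layer} (h : Move p q) :
    Move (p.map Layer.mirror) (q.map Layer.mirror) := by
  cases h with
  | exchange p y q =>
    have hb (p : Piece) : p.mirror.bot = p.bot := by cases p <;> rfl
    have ht (p : Piece) : p.mirror.top = p.top := by cases p <;> rfl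
    simpa [Layer.mirror, hb, ht] using Move.exchange p.mirror y q.mirror
  | zigzagLeft a => exact .zigzagLeft a
  | zigzagRight a => exact .zigzagRight a
  | slideCap v c o => exact .slideCap (!v) c o
  | slideCup v c o => exact .slideCup (!v) c o
  | reidemeisterOneCap v a => exact .reidemeisterOneCap (!v) a
  | reidemeisterOneCup v a => exact .reidemeisterOneCup (!v) a
  | reidemeisterTwo v a b => exact .reidemeisterTwo (!v) a b
  | reidemeisterThree v₁ v₂ v₃ a b c h =>
    exact .reidemeisterThree (!v₁) (!v₂) (!v₃) a b c
      (by cases v₁ <;> cases v₂ <;> cases v₃ <;> simp at h ⊢)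

theorem Move.reverse {p q : List Layer} (h : Move p q) :
    Move (p.map Layer.reverse) (q.map Layer.reverse) := by
  cases h with
  | exchange p y q =>
    have hb (p : Piece) : p.reverse.bot = p.bot.map not := by cases p <;> rfl
    have ht (p : Piece) : p.reverse.top = p.top.map not := by cases p <;> rfl
    simpa [Layer.reverse, hb, ht] using Move.exchange p.reverse (y.map not) q.reverse
  | zigzagLeft a => exact .zigzagLeft (!a)
  | zigzagRight a => exact .zigzagRight (!a)
  | slideCap v c o => exact .slideCap v (!c) (!o)
  | slideCup v c o => exact .slideCup v (!c) (!o)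
  | reidemeisterOneCap v a => exact .reidemeisterOneCap v (!a)
  | reidemeisterOneCup v a => exact .reidemeisterOneCup v (!a)
  | reidemeisterTwo v a b => exact .reidemeisterTwo v (!a) (!b)
  | reidemeisterThree v₁ v₂ v₃ a b c h =>
    exact .reidemeisterThree v₁ v₂ v₃ (!a) (!b) (!c) h

theorem Isotopic.mirror {L L' : LinkDiagram} (h : Isotopic L L') :
    Isotopic L.mirror L'.mirror :=
  isotopic_map Layer.mirror id (fun _ => rfl)
    (fun x y w => by simp [pad, Layer.mirror, Function.comp_def]) (fun _ _ => Move.mirror) h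

theorem Isotopic.reverse {L L' : LinkDiagram} (h : Isotopic L L') :
    Isotopic L.reverse L'.reverse :=
  isotopic_map Layer.reverse (List.map not) (fun _ => rfl)
    (fun x y w => by simp [pad, Layer.reverse, Function.comp_def]) (fun _ _ => Move.reverse) h

theorem IsSkein.red {K : Type} [CommRing K] {φ : LaurentLM →+* K} {x : List Bool}
    {f : List Layer → K} (hf : IsSkein φ x f) {w w' : List Layer} (h : w ⇝ w')
    (hg : Goes [] w x) : f w = f w' := hf.iso (h _ _ hg)

theorem onWords_circle {P : LinkDiagram → LaurentLM} (hP : IsHomfly P) (o : Bool) :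
    onWords P [⟨[], .cup o, []⟩, ⟨[], .cap o, []⟩] = 1 := by
  have h : onWords P unknot.word = 1 := by rw [onWords_word, hP.normalization]
  cases o
  · rw [hP.isSkein.red (circle_flip false []).1]
    · exact h
    · simp [Layer.bot, Layer.top, Piece.bot, Piece.top]
  · exact h

/-- Exchanging `l` and its inverse. -/
noncomputable def conj : LaurentLM →+* LaurentLM :=
  LaurentPolynomial.eval₂
    (LaurentPolynomial.C.comp (LaurentPolynomial.invert : ℂ[T;T⁻¹] ≃ₐ[ℂ] ℂ[T;T⁻¹]).toRingHom)
    ⟨varM, varMInv, varM_mul_inv, by rw [mul_comm]; exact varM_mul_inv⟩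

theorem conj_C (a : ℂ[T;T⁻¹]) :
    conj (LaurentPolynomial.C a) = LaurentPolynomial.C (LaurentPolynomial.invert a) := by
  rw [conj, LaurentPolynomial.eval₂_C]; rfl

theorem conj_varM : conj varM = varM := by
  rw [conj, LaurentPolynomial.eval₂_T, zpow_one]

theorem SkeinTriple.mirror {Lp Lm Lz : LinkDiagram} (h : SkeinTriple Lp Lm Lz) :
    SkeinTriple Lm.mirror Lp.mirror Lz.mirror := by
  obtain ⟨u, w, x, y, vp, vm, a, b, hp, hm, h1, h2, h3⟩ := h
  refine ⟨u.map Layer.mirror, w.map Layer.mirror, x, y, !vm, !vp, a, b, ?_, ?_, ?_, ?_, ?_⟩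
  · revert hm; cases vm <;> cases a <;> cases b <;> simp [isPositive]
  · revert hp; cases vp <;> cases a <;> cases b <;> simp [isPositive]
  · simp [LinkDiagram.mirror, h2, Layer.mirror, Piece.mirror]
  · simp [LinkDiagram.mirror, h1, Layer.mirror, Piece.mirror]
  · simp only [LinkDiagram.mirror, h3, List.map_append, smoothing]
    split_ifs <;> simp [Layer.mirror, Piece.mirror]

theorem SkeinTriple.reverse {Lp Lm Lz : LinkDiagram} (h : SkeinTriple Lp Lm Lz) :
    SkeinTriple Lp.reverse Lm.reverse Lz.reverse := by
  obtain ⟨u, w, x, y, vp, vm, a, b, hp, hm, h1, h2, h3⟩ := h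
  refine ⟨u.map Layer.reverse, w.map Layer.reverse, x.map not, y.map not, vp, vm, !a, !b,
    ?_, ?_, ?_, ?_, ?_⟩
  · rw [← hp]; cases a <;> cases b <;> simp [isPositive]
  · rw [← hm]; cases a <;> cases b <;> simp [isPositive]
  · simp [LinkDiagram.reverse, h1, Layer.reverse, Piece.reverse]
  · simp [LinkDiagram.reverse, h2, Layer.reverse, Piece.reverse]
  · simp only [LinkDiagram.reverse, h3, List.map_append, smoothing, Bool.not_inj_iff]
    split_ifs <;> simp [Layer.reverse, Piece.reverse]

/-- The mirror image exchanges `L₊` and `L₋`, which `conj` compensates. -/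
theorem IsHomfly.mirror {P : LinkDiagram → LaurentLM} (hP : IsHomfly P) :
    IsHomfly fun L => conj (P L.mirror) where
  invariant L L' h := congrArg conj (hP.invariant _ _ h.mirror)
  normalization := by
    have : unknot.mirror = unknot := rfl
    rw [this, hP.normalization, map_one]
  skein Lp Lm Lz h := by
    have h1 := congrArg conj (hP.skein _ _ _ h.mirror)
    rw [map_add, map_add, map_mul, map_mul, map_mul, map_zero, conj_C, conj_C, conj_varM,
      LaurentPolynomial.invert_T, LaurentPolynomial.invert_T, neg_neg] at h1
    rwa [add_comm (LaurentPolynomial.C (LaurentPolynomial.T 1) * _)]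

theorem IsHomfly.reverse {P : LinkDiagram → LaurentLM} (hP : IsHomfly P) :
    IsHomfly fun L => P L.reverse where
  invariant L L' h := hP.invariant _ _ h.reverse
  normalization := by
    rw [← onWords_word P]
    exact onWords_circle hP false
  skein Lp Lm Lz h := hP.skein _ _ _ h.reverse

/-! ### Distant unions and connected sums -/

/-- With one factor fixed, the value is a skein function of the other, so each factor in turn is
replaced by an unknot. -/
theorem IsHomfly.union {P : LinkDiagram → LaurentLM} (hP : IsHomfly P) (L₁ L₂ : LinkDiagram) :
    P (L₁.union L₂) = P L₁ * P L₂ * P (unknot.union unknot) := by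
  have h1 := L₁.eval_spec (hP.isSkein.context (u := []) (a := []) (b := []) rfl
    (by simpa using L₂.goes))
  have h2 := L₂.eval_spec (hP.isSkein.context (u := unknot.word) (a := []) (b := []) (t := [])
    unknot.goes rfl)
  simp only [List.nil_append, List.append_nil, pad_nil_nil, RingHom.id_apply] at h1 h2
  rw [h2, ← hP.eq_eval, ← hP.eq_eval, ← mul_assoc] at h1
  have e (L L' : LinkDiagram) : onWords P (L.word ++ L'.word) = P (L.union L') :=
    onWords_word P (L.union L')
  rwa [e, e] at h1

/-- This is the skein relation at the crossing of a figure eight, which is an unknot for either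
sign. -/
theorem IsHomfly.two_circles {P : LinkDiagram → LaurentLM} (hP : IsHomfly P) :
    varL + varLInv + varM * P (unknot.union unknot) = 0 := by
  have g (v : Bool) : Goes [] ([⟨[], .cup true, []⟩] ++ [⟨[], .cross v true false, []⟩] ++
      [⟨[], .cap false, []⟩]) [] := by
    simp [Layer.bot, Layer.top, Piece.bot, Piece.top]
  have h1 (v : Bool) : onWords P ([⟨[], .cup true, []⟩] ++ [⟨[], .cross v true false, []⟩] ++
      [⟨[], .cap false, []⟩]) = 1 := by
    have h := (Move.reidemeisterOneCap v true).red.within [] [] [⟨[], .cup true, []⟩] []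
    exact (hP.isSkein.red h (g v)).trans (onWords_circle hP true)
  have h2 := hP.isSkein.skein [⟨[], .cup true, []⟩] [⟨[], .cap false, []⟩] [] [] false true
    true false rfl rfl (g _)
  rw [h1, h1, mul_one, mul_one] at h2
  have h3 : onWords P ([⟨[], .cup true, []⟩] ++ smoothing true false [] [] ++
      [⟨[], .cap false, []⟩]) = P (unknot.union unknot) := by
    rw [← onWords_word P]
    refine hP.isSkein.red ?_ ?_
    · exact (Red.refl [⟨[], .cup true, []⟩, ⟨[], .cap true, []⟩]).append (circle_flip false []).1
    · simp [smoothing, Layer.bot, Layer.top, Piece.bot, Piece.top]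
  rw [h3] at h2
  exact h2

theorem IsHomfly.connectedSum {P : LinkDiagram → LaurentLM} (hP : IsHomfly P)
    {L₁ L₂ L : LinkDiagram} (h : IsConnectedSum L₁ L₂ L) : P L = P L₁ * P L₂ := by
  obtain ⟨u, w, t, x, y, o, K₁, K₂, K, hu, hw, ht, e1, e2, e, i1, i2, i⟩ := h
  rw [hP.invariant _ _ i1, hP.invariant _ _ i2, hP.invariant _ _ i, ← onWords_word P K₁,
    ← onWords_word P K₂, ← onWords_word P K, e1, e2, e]
  have hf := hP.isSkein
  have hT : Goes [] ([⟨[], .cup o, []⟩] ++ pad [] [!o] t) [o, !o] := by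
    refine Goes.append (y := [o, !o]) (by simp [Layer.bot, Layer.top, Piece.bot, Piece.top]) ?_
    simpa using goes_pad [] [!o] ht
  have hu' : Goes [] u (x ++ (o :: y)) := by simpa using hu
  have hw' : Goes (x ++ o :: y) w [] := by simpa using hw
  have hcap : Goes (x ++ [o, !o] ++ (o :: y)) ([⟨x ++ [o], .cap (!o), y⟩] ++ w) [] := by
    refine Goes.append (y := x ++ (o :: y)) ?_ hw'
    simp [Layer.bot, Layer.top, Piece.bot, Piece.top]
  -- The tangle `t`, bent into two upper end points, is `p` times a minimum. This `p` is used in two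
  -- contexts: closed by a maximum, and inserted into the diagram of `L₁`.
  obtain ⟨p, hp⟩ := (gen_cup hT).exists_eval
  have h2 := hp _ _ _ (hf.context (u := []) (a := []) (b := []) (t := [⟨[], .cap o, []⟩]) rfl
    (by simp [Layer.bot, Layer.top, Piece.bot, Piece.top]))
  have h1 := hp _ _ _ (hf.context (u := u) (a := x) (b := o :: y) hu' hcap)
  simp only [List.nil_append, pad_nil_nil, RingHom.id_apply, List.cons_append] at h1 h2
  rw [onWords_circle hP, mul_one] at h2
  have k1 : onWords P (u ++ pad x (o :: y) [⟨[], .cup o, []⟩] ++ ⟨x ++ [o], .cap (!o), y⟩ :: w) =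
      onWords P (u ++ w) := by
    refine hf.red ?_ ?_
    · have := (Move.zigzagRight o).red.within x y u w
      simp at this
      simpa using this
    · refine (hu'.append (?_ : Goes _ _ (x ++ [o, !o] ++ (o :: y)))).append (by simpa using hcap)
      simp [Layer.bot, Layer.top, Piece.bot, Piece.top]
  have k2 : onWords P (u ++ pad x (o :: y) (⟨[], .cup o, []⟩ :: pad [] [!o] t) ++
      ⟨x ++ [o], .cap (!o), y⟩ :: w) = onWords P (u ++ pad x y t ++ w) := by
    refine hf.red ?_ ?_
    · have r1 := (exchange_words ht (y := [!o, o]) (y' := []) (t := [⟨[], .cap (!o), []⟩])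
        (by simp [Layer.bot, Layer.top, Piece.bot, Piece.top])).1.within x y
        (u ++ [⟨x, .cup o, o :: y⟩]) w
      have r2 := (Move.zigzagRight o).red.within x y u (pad x y t ++ w)
      simp at r1 r2
      simpa using r1.trans r2
    · have hT' := goes_pad x (o :: y) hT
      rw [List.append_nil] at hT'
      exact (hu'.append hT').append hcap
  rw [k1, k2] at h1
  rw [h1, mul_comm]
  congr 1
  simpa [closure] using h2.symm

/-! ### The specialization -/

theorem specialize_C (a : ℂ[T;T⁻¹]) : specialize (LaurentPolynomial.C a) = a := by
  rw [specialize, LaurentPolynomial.eval₂_C]; rfl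

theorem specialize_varM : specialize varM = LaurentPolynomial.C (-2) := by
  rw [specialize, LaurentPolynomial.eval₂_T, zpow_one]; rfl

theorem specialize_conj (p : LaurentLM) :
    specialize (conj p) = LaurentPolynomial.invert (specialize p) := by
  have h : specialize.comp conj =
      (LaurentPolynomial.invert : ℂ[T;T⁻¹] ≃ₐ[ℂ] ℂ[T;T⁻¹]).toRingEquiv.toRingHom.comp
        specialize := by
    refine laurent_hom_ext (fun a => ?_) ?_
    · rw [RingHom.comp_apply, RingHom.comp_apply, conj_C, specialize_C, specialize_C]; rfl
    · rw [RingHom.comp_apply, RingHom.comp_apply, conj_varM, specialize_varM]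
      exact (LaurentPolynomial.invert_C _).symm
  have h' := RingHom.congr_fun h p
  rw [RingHom.comp_apply, RingHom.comp_apply] at h'
  exact h'

theorem degenerateD_two_circles : degenerateD (unknot.union unknot) =
    LaurentPolynomial.C (1 / 2 : ℂ) * LaurentPolynomial.T (-1) * (LaurentPolynomial.T 2 + 1) := by
  have h := congrArg specialize isHomfly_homfly.two_circles
  rw [map_add, map_add, map_mul, map_zero, specialize_C, specialize_C, specialize_varM] at h
  change _ + LaurentPolynomial.C (-2) * degenerateD _ = 0 at h
  have h2 : (LaurentPolynomial.C (1 / 2 : ℂ) : ℂ[T;T⁻¹]) * LaurentPolynomial.C (-2) = -1 := by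
    rw [← map_mul]; norm_num
  have h3 : (LaurentPolynomial.T (-1) : ℂ[T;T⁻¹]) * LaurentPolynomial.T 2 =
      LaurentPolynomial.T 1 := by
    rw [← LaurentPolynomial.T_add]; norm_num
  linear_combination (-(LaurentPolynomial.C (1 / 2 : ℂ))) * h +
    degenerateD (unknot.union unknot) * h2 - LaurentPolynomial.C (1 / 2 : ℂ) * h3

end OrientedLinks

/-! ### Assembly of the four properties -/

theorem mainTheorem10 :
    -- the HOMFLY polynomial, of which `degenerateD` is a specialization, exists and is unique
    (OrientedLinks.IsHomfly OrientedLinks.homfly ∧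
      ∀ P, OrientedLinks.IsHomfly P → P = OrientedLinks.homfly) ∧
    -- distant union
    (∀ L₁ L₂ : OrientedLinks.LinkDiagram,
      OrientedLinks.degenerateD (L₁.union L₂) =
        LaurentPolynomial.C (1 / 2 : ℂ) * LaurentPolynomial.T (-1) *
          (LaurentPolynomial.T 2 + 1) *
          OrientedLinks.degenerateD L₁ * OrientedLinks.degenerateD L₂) ∧
    -- mirror image
    (∀ L : OrientedLinks.LinkDiagram,
      OrientedLinks.degenerateD L.mirror =
        LaurentPolynomial.invert (OrientedLinks.degenerateD L)) ∧
    -- connected sum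
    (∀ L₁ L₂ L : OrientedLinks.LinkDiagram, OrientedLinks.IsConnectedSum L₁ L₂ L →
      OrientedLinks.degenerateD L =
        OrientedLinks.degenerateD L₁ * OrientedLinks.degenerateD L₂) ∧
    -- reversal of all orientations
    (∀ L : OrientedLinks.LinkDiagram,
      OrientedLinks.degenerateD L.reverse = OrientedLinks.degenerateD L) := by
  refine ⟨⟨OrientedLinks.isHomfly_homfly, fun P hP => hP.eq_homfly⟩, fun L₁ L₂ => ?_, fun L => ?_,
    fun L₁ L₂ L h => ?_, fun L => ?_⟩
  · have h := congrArg OrientedLinks.specialize (OrientedLinks.isHomfly_homfly.union L₁ L₂)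
    rw [map_mul, map_mul] at h
    rw [← OrientedLinks.degenerateD_two_circles]
    exact h.trans (by rw [mul_comm, mul_assoc]; rfl)
  · have h := congrFun OrientedLinks.isHomfly_homfly.mirror.eq_homfly L
    rw [OrientedLinks.degenerateD, OrientedLinks.degenerateD, ← h, OrientedLinks.specialize_conj]
    -- Uniqueness expresses `D(L)` through the mirror image; inverting `s` once more gives the
    -- stated direction.
    exact (LaurentPolynomial.involutive_invert _).symm
  · rw [OrientedLinks.degenerateD, OrientedLinks.isHomfly_homfly.connectedSum h, map_mul]
    rfl
  · rw [OrientedLinks.degenerateD, congrFun OrientedLinks.isHomfly_homfly.reverse.eq_homfly L]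
    rfl
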